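/- \textbf{Definitions.} Let $J\subseteq\mathbb{R}$ be an open interval and $f,s:J\to\mathbb{R}$. Write $f\in\mathrm{GSPACE}(J,s)$ if there are $d\ge 1$, a vector of real polynomials $p:\mathbb{R}^d\to\mathbb{R}^d$, $t_0\in J$ and $y_0\in\mathbb{R}^d$ such that the initial value problem $y'=p(y)$, $y(t_0)=y_0$ has a (necessarily unique) solution $y$ on all of $J$, and $f(t)=y_1(t)$ and $\|y(t)\|_\infty\le s(t)$ for all $t\in J$. A function $g:J\to\mathbb{R}^e$ is in $\mathrm{GSPACE}(J,s)$ if each of its components is. For an open set $U\subseteq\mathbb{R}^d$ and $f,s_f:U\to\mathbb{R}$, write $f\in\mathrm{GSPACE}(U,s_f)$ if for every open interval $J$, every $s_g : J\to\mathbb{R}$ and every $g\in\mathrm{GSPACE}(J,s_g)$ with $g:J\to\mathbb{R}^d$ and $g(J)\subseteq U$, one has $f\circ g\in\mathrm{GSPACE}(J,\max(s_g,s_f\circ s_g))$, where $(s_f\circ s_g)(t)=s_f(s_g(t),\dots,s_g(t))$; for $f:U\to\mathbb{R}^e$ this is required of each component. Let $\mathcal M$ be a one-tape Turing machine with state set $Q=\{0,\dots,m-1\}$,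 tape alphabet $\Sigma=\{0,\dots,k-2\}$ ($k\ge 2$), blank symbol $0$ and total transition function $\delta:Q\times\Sigma\to Q\times\Sigma\times\{L,R\}$ (write, move, change state; a halting machine stays in its final states). A configuration $c=(x,s,y,q)$ consists of the tape contents $x=x_0x_1\cdots$ to the left and $y=y_0y_1\cdots$ to the right of the head, both read away from the head and with finitely many non-blank symbols, the scanned symbol $s$ and the state $q$. Its rational encoding is $[c]=(0.x,\,s,\,0.y,\,q)\in\mathbb{R}^4$, where $0.x=\sum_{i\ge 0}x_ik^{-i-1}$ and $0.y=\sum_{i\ge 0}y_ik^{-i-1}$. \textbf{Theorem.} For every such Turing machine $\mathcal M$ there are a function $s_f:(0,\infty)^3\to\mathbb{R}$ and a polynomial $P\in\mathbb{R}[S,T]$ with $$|s_f(S,T,n)|\le P(S,T)\qquad\text{for all real } S,T>0 \text{ and } 0<n\le T,$$ such that for every configuration $c_0$ of $\mathcal M$ there is a function $f_{\mathcal M}:(0,\infty)^3\to\mathbb{R}^4$ in $\mathrm{GSPACE}((0,\infty)^3,s_f)$ such that, for the sequence $c_0,c_1,c_2,\dots$ of configurations of $\mathcal M$ starting from $c_0$,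 $$\|[c_n]-f_{\mathcal M}(S,T,n)\|_\infty\le e^{-S}\qquad\text{for all real } S,T>0\text{ and all integers } n \text{ with } 1\le n\le T.$$ -/

import Mathlib

namespace GPAC

/-! ## Functions generated by polynomial initial value problems, with a space bound -/

/-- `GSpace I f s`, for an open interval `I` and `f, s : I → ℝ` : there are a polynomial system
`y' = p(y)`, `y(t₀) = y₀` with `t₀ ∈ I` (in some dimension `d + 1 ≥ 1`), and its solution `y` on
the whole of `I`, such that `f` is the first component of `y` and the sup norm of `y` is at most
`s` on `I`. (On an interval this solution is unique, the right-hand side being locally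
Lipschitz.) Only the values of `f` and `s` on `I` matter. -/
def GSpace (I : Set ℝ) (f s : ℝ → ℝ) : Prop :=
  ∃ (d : ℕ) (p : Fin (d + 1) → MvPolynomial (Fin (d + 1)) ℝ) (t₀ : ℝ) (y₀ : Fin (d + 1) → ℝ)
    (y : ℝ → Fin (d + 1) → ℝ),
    t₀ ∈ I ∧ y t₀ = y₀ ∧
    (∀ t ∈ I, HasDerivAt y (fun i => MvPolynomial.eval (y t) (p i)) t) ∧
    ∀ t ∈ I, f t = y t 0 ∧ ‖y t‖ ≤ s t

/-- The same class for vector-valued `f : I → ℝᵉ`, componentwise, with a common bound `s`. -/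
def GSpaceVec {e : ℕ} (I : Set ℝ) (f : ℝ → Fin e → ℝ) (s : ℝ → ℝ) : Prop :=
  ∀ i : Fin e, GSpace I (fun t => f t i) s

/-- The class for `f, s_f : U → ℝ` with `U ⊆ ℝᵈ` open: whenever `g : J → ℝᵈ` is generated on an
open interval `J` with bound `s_g` and takes its values in `U`, the composite `f ∘ g` is generated
on `J` with bound `max (s_g, s_f ∘ s_g)`, where `s_f ∘ s_g` is `t ↦ s_f (s_g t, …, s_g t)`. -/
def GSpaceMulti {d : ℕ} (U : Set (Fin d → ℝ)) (f s_f : (Fin d → ℝ) → ℝ) : Prop :=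
  ∀ J : Set ℝ, IsOpen J → J.OrdConnected →
    ∀ (g : ℝ → Fin d → ℝ) (s_g : ℝ → ℝ), GSpaceVec J g s_g → (∀ t ∈ J, g t ∈ U) →
      GSpace J (fun t => f (g t)) (fun t => max (s_g t) (s_f (fun _ => s_g t)))

/-- The class for `f : U → ℝᵉ` with `U ⊆ ℝᵈ` open, componentwise. -/
def GSpaceMultiVec {d e : ℕ} (U : Set (Fin d → ℝ)) (f : (Fin d → ℝ) → Fin e → ℝ)
    (s_f : (Fin d → ℝ) → ℝ) : Prop :=
  ∀ i : Fin e, GSpaceMulti U (fun v => f v i) s_f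

/-- The open positive octant `(0, ∞)³`. -/
def posOctant : Set (Fin 3 → ℝ) := {v | ∀ i, 0 < v i}

/-! ## Turing machines -/

/-- A one-tape Turing machine with states `{0, …, m - 1}`, symbols `{0, …, k - 2}` where
`k = r + 2`, blank symbol `0`, and a total transition function. A machine that halts is one that
stays in its final states. -/
structure Machine where
  m : ℕ
  r : ℕ
  δ : Fin m × Fin (r + 1) → Fin m × Fin (r + 1) × Turing.Dir

namespace Machine

/-- The base of the encoding: one more than the number of tape symbols. -/
def k (M : Machine) : ℕ := M.r + 2

/-- A configuration: the two-sided tape (left part, scanned symbol, right part; both parts are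
blank from some cell on) and the state. The default element of `Fin (r + 1)`, which Mathlib's tapes
use as the blank, is `0`. -/
structure Config (M : Machine) where
  tape : Turing.Tape (Fin (M.r + 1))
  state : Fin M.m

/-- One step: write the new symbol, move the head, change the state. -/
def step (M : Machine) (c : M.Config) : M.Config :=
  let a := M.δ (c.state, c.tape.head)
  { tape := (c.tape.write a.2.1).move a.2.2
    state := a.1 }

/-- `0.x = x₀ k⁻¹ + x₁ k⁻² + ⋯` for a half-tape `x₀ x₁ x₂ ⋯`, read away from the head. Almost all
`xᵢ` are zero, so this is a finite sum. -/
noncomputable def frac (M : Machine) (x : Turing.ListBlank (Fin (M.r + 1))) : ℝ :=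
  ∑' i : ℕ, ((x.nth i : ℕ) : ℝ) / (M.k : ℝ) ^ (i + 1)

/-- The rational encoding `[c] = (0.x, s, 0.y, q)` of the configuration with left half-tape `x`,
scanned symbol `s`, right half-tape `y` and state `q`. -/
noncomputable def encode (M : Machine) (c : M.Config) : Fin 4 → ℝ :=
  ![M.frac c.tape.left, ((c.tape.head : ℕ) : ℝ), M.frac c.tape.right, ((c.state : ℕ) : ℝ)]

end Machine

end GPAC

namespace GPAC

/-! ## A class of functions closed under differentiation -/

section Gen

variable {A ι κ : Type*} [Fintype ι] [Fintype κ]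

/-! A single bounded solution `y` of a differential equation in time `t`, which does not involve
`S`, `T` or `n`, simulates the machine again and again with growing precision. The function `f` then
reads `y` at a time computed smoothly from `(S, T, n)`.

Simulation (`exists_iteration`). A periodic clock alternately drives `y` towards the image of a
memory `z` under a smooth transition map, and `z` towards `y`, so one unit of time is one machine
step. All gates have error about `exp (-t)`. A step multiplies the accumulated error by at most a
constant, so `n ≤ M` steps started near time `M ^ 2` end with error `(2K) ^ M * exp (-(M ^ 2 - 1))`
up to a constant factor, hence at most `exp (-M)` for large `M`. To restart at ever later times, a
signal built from `sin (π √t)` forces `y` back to the initial configuration while `⌊√t⌋` is even and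
lets it run while `⌊√t⌋` is odd.

Robustness (`Machine.softStep_close`). There are `k - 1` symbols in base `k`, so the encodings of
half-tapes with different leading digits are separated by gaps. Digits and states can thus be
recovered by sigmoids, with exponentially small error.

Reading. An odd `M ≥ S + T` is obtained by smooth rounding of `a = M₀ + 1 + S + T`, and `y` is read
near `M ^ 2 + n`. Rounding fails when `a` is near a half-integer, so the readings for `a` and `a +
1/2` are blended with a weight that nearly kills the unreliable one. An unreliable reading is still
bounded, because `y` stays in a fixed box.

Space (`IsGen.gSpaceMulti`). Everything is built inside `IsGen`: polynomials in a finite family of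
polynomially bounded functions that is closed under partial derivatives in the polynomial sense.
Composing with a curve generated by a polynomial system gives a larger polynomial system, with a
polynomial bound. The parameter `a : A` stands for the initial configuration; the constants are
uniform in it, so one `s_f` serves all configurations. -/

/-- Bounded on `U` by a polynomial in the norm, uniformly in the parameter. -/
def PolyBdd (U : Set (ι → ℝ)) (f : A → (ι → ℝ) → ℝ) : Prop :=
  ∃ (C : ℝ) (p : ℕ), 0 ≤ C ∧ ∀ a, ∀ v ∈ U, |f a v| ≤ C * (1 + ‖v‖) ^ p

/-- `f` has partial derivatives `D j` on `U`. -/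
def HasGrad (U : Set (ι → ℝ)) (f : A → (ι → ℝ) → ℝ) (D : ι → A → (ι → ℝ) → ℝ) : Prop :=
  ∀ a, ∀ v ∈ U, HasFDerivAt (f a)
    (∑ j, D j a v • (ContinuousLinearMap.proj j : (ι → ℝ) →L[ℝ] ℝ)) v

/-- A finite set of polynomially bounded functions whose partial derivatives are polynomials in
the functions of the set. -/
structure IsGenSystem (U : Set (ι → ℝ)) (W : Set (A → (ι → ℝ) → ℝ)) : Prop where
  finite : W.Finite
  bdd : ∀ w ∈ W, PolyBdd U w
  grad : ∀ w ∈ W, ∃ D : ι → A → (ι → ℝ) → ℝ,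
    (∀ j, D j ∈ Algebra.adjoin ℝ W) ∧ HasGrad U w D

variable {U : Set (ι → ℝ)} {V : Set (κ → ℝ)}

/-- Monotone form, so that finitely many functions can share one constant and one exponent, and a
space bound `s` can replace the norm. -/
lemma PolyBdd.exists_ge {f : A → (ι → ℝ) → ℝ} (h : PolyBdd U f) :
    ∃ (C : ℝ) (p : ℕ), 0 ≤ C ∧ ∀ C' ≥ C, ∀ p' ≥ p, ∀ a, ∀ v ∈ U, ∀ s ≥ ‖v‖,
      |f a v| ≤ C' * (1 + s) ^ p' := by
  obtain ⟨C, p, hC, h⟩ := h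
  refine ⟨C, p, hC, fun C' hC' p' hp' a v hv s hs => (h a v hv).trans ?_⟩
  have h0 := norm_nonneg v
  have h1 : (1 + ‖v‖) ^ p ≤ (1 + s) ^ p := by gcongr
  have h2 : (1 + s) ^ p ≤ (1 + s) ^ p' := pow_le_pow_right₀ (by linarith) hp'
  exact mul_le_mul hC' (h1.trans h2) (by positivity) (hC.trans hC')

lemma PolyBdd.of_abs_le {f : A → (ι → ℝ) → ℝ} (C : ℝ) (h : ∀ a, ∀ v ∈ U, |f a v| ≤ C) :
    PolyBdd U f :=
  ⟨|C|, 0, abs_nonneg C, fun a v hv => by simpa using (h a v hv).trans (le_abs_self C)⟩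

lemma PolyBdd.add {f g : A → (ι → ℝ) → ℝ} (hf : PolyBdd U f) (hg : PolyBdd U g) :
    PolyBdd U (f + g) := by
  obtain ⟨C, p, hC, hf⟩ := hf.exists_ge
  obtain ⟨C', p', hC', hg⟩ := hg.exists_ge
  refine ⟨C + C', p + p', by positivity, fun a v hv => ?_⟩
  have h1 := hf C le_rfl (p + p') (by omega) a v hv _ le_rfl
  have h2 := hg C' le_rfl (p + p') (by omega) a v hv _ le_rfl
  calc |f a v + g a v| ≤ _ := abs_add_le _ _
    _ ≤ _ := by linarith

lemma PolyBdd.mul {f g : A → (ι → ℝ) → ℝ} (hf : PolyBdd U f) (hg : PolyBdd U g) :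
    PolyBdd U (f * g) := by
  obtain ⟨C, p, hC, hf⟩ := hf
  obtain ⟨C', p', hC', hg⟩ := hg
  refine ⟨C * C', p + p', by positivity, fun a v hv => ?_⟩
  calc |f a v * g a v| = |f a v| * |g a v| := abs_mul _ _
    _ ≤ (C * (1 + ‖v‖) ^ p) * (C' * (1 + ‖v‖) ^ p') :=
      mul_le_mul (hf a v hv) (hg a v hv) (abs_nonneg _) (by positivity)
    _ = _ := by ring

lemma PolyBdd.adjoin {W : Set (A → (ι → ℝ) → ℝ)} (hW : ∀ w ∈ W, PolyBdd U w)
    {f : A → (ι → ℝ) → ℝ} (hf : f ∈ Algebra.adjoin ℝ W) : PolyBdd U f := by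
  induction hf using Algebra.adjoin_induction with
  | mem x hx => exact hW x hx
  | algebraMap r => exact .of_abs_le |r| fun a v _ => by simp
  | add x y _ _ hx hy => exact hx.add hy
  | mul x y _ _ hx hy => exact hx.mul hy

/-- Composition of a family of functions of `κ → ℝ` with a family of maps to `κ → ℝ`. -/
def pull (h : κ → A → (ι → ℝ) → ℝ) :
    (A → (κ → ℝ) → ℝ) →ₐ[ℝ] (A → (ι → ℝ) → ℝ) where
  toFun w := fun a v => w a fun i => h i a v
  map_one' := rfl
  map_mul' _ _ := rfl
  map_zero' := rfl
  map_add' _ _ := rfl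
  commutes' _ := rfl

omit [Fintype ι] [Fintype κ] in
@[simp]
lemma pull_apply (h : κ → A → (ι → ℝ) → ℝ) (f : A → (κ → ℝ) → ℝ) (a : A) (v : ι → ℝ) :
    pull h f a v = f a fun i => h i a v := rfl

omit [Fintype ι] [Fintype κ] in
lemma pull_mem_adjoin (h : κ → A → (ι → ℝ) → ℝ) {W : Set (A → (κ → ℝ) → ℝ)}
    {f : A → (κ → ℝ) → ℝ} (hf : f ∈ Algebra.adjoin ℝ W) :
    pull h f ∈ Algebra.adjoin ℝ (pull h '' W) := by
  rw [← AlgHom.map_adjoin]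
  exact Subalgebra.mem_map.2 ⟨f, hf, rfl⟩

lemma PolyBdd.pull {h : κ → A → (ι → ℝ) → ℝ} (hh : ∀ i, PolyBdd U (h i))
    (hUV : ∀ a, ∀ v ∈ U, (fun i => h i a v) ∈ V) {f : A → (κ → ℝ) → ℝ} (hf : PolyBdd V f) :
    PolyBdd U (pull h f) := by
  choose C p hC hh using hh
  obtain ⟨C', p', hC', hf⟩ := hf
  refine ⟨C' * (1 + ∑ i, C i) ^ p', (∑ i, p i) * p', ?_, fun a v hv => ?_⟩
  · have : 0 ≤ ∑ i, C i := Finset.sum_nonneg fun i _ => hC i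
    positivity
  have h0 := norm_nonneg v
  have hS : 0 ≤ ∑ i, C i := Finset.sum_nonneg fun i _ => hC i
  have h1 : 1 ≤ (1 + ‖v‖) ^ (∑ i, p i) := one_le_pow₀ (by linarith)
  have key : ‖fun i => h i a v‖ ≤ (∑ i, C i) * (1 + ‖v‖) ^ (∑ i, p i) := by
    refine (pi_norm_le_iff_of_nonneg (by positivity)).2 fun i => ?_
    refine (hh i a v hv).trans ?_
    have h2 : C i ≤ ∑ i, C i := Finset.single_le_sum (fun i _ => hC i) (Finset.mem_univ i)
    have h3 : p i ≤ ∑ i, p i := Finset.single_le_sum (fun i _ => by omega) (Finset.mem_univ i)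
    exact mul_le_mul h2 (pow_le_pow_right₀ (by linarith) h3) (by positivity) hS
  refine (hf a _ (hUV a v hv)).trans ?_
  rw [mul_assoc, pow_mul, ← mul_pow]
  gcongr
  nlinarith

lemma HasGrad.add {f g : A → (ι → ℝ) → ℝ} {D E : ι → A → (ι → ℝ) → ℝ} (hf : HasGrad U f D)
    (hg : HasGrad U g E) : HasGrad U (f + g) (fun j => D j + E j) := fun a v hv => by
  have := (hf a v hv).add (hg a v hv)
  convert! this using 1
  simp [add_smul, Finset.sum_add_distrib]

lemma HasGrad.mul {f g : A → (ι → ℝ) → ℝ} {D E : ι → A → (ι → ℝ) → ℝ} (hf : HasGrad U f D)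
    (hg : HasGrad U g E) : HasGrad U (f * g) (fun j => f * E j + g * D j) := fun a v hv => by
  have := (hf a v hv).mul (hg a v hv)
  convert! this using 1
  simp [add_smul, Finset.sum_add_distrib, Finset.smul_sum, smul_smul]

lemma HasGrad.const (c : A → ℝ) : HasGrad U (fun a _ => c a) (fun _ => 0) := fun a v _ => by
  simpa using hasFDerivAt_const (c a) v

lemma HasGrad.coord (i : ι) [DecidableEq ι] : HasGrad U (fun (_ : A) v => v i)
    (fun j => algebraMap ℝ _ (if j = i then 1 else 0)) := fun a v _ => by
  have : HasFDerivAt (fun v : ι → ℝ => v i) (ContinuousLinearMap.proj i : (ι → ℝ) →L[ℝ] ℝ) v :=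
    hasFDerivAt_apply i v
  convert! this using 1
  ext w
  simp

lemma HasGrad.comp {h : κ → A → (ι → ℝ) → ℝ} {D : κ → ι → A → (ι → ℝ) → ℝ}
    (hD : ∀ i, HasGrad U (h i) (D i)) (hUV : ∀ a, ∀ v ∈ U, (fun i => h i a v) ∈ V)
    {f : A → (κ → ℝ) → ℝ} {E : κ → A → (κ → ℝ) → ℝ} (hf : HasGrad V f E) :
    HasGrad U (pull h f) (fun j => ∑ i, pull h (E i) * D i j) := fun a v hv => by
  have h1 : HasFDerivAt (fun v => fun i => h i a v) _ v := hasFDerivAt_pi.2 fun i => hD i a v hv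
  have := (hf a _ (hUV a v hv)).comp v h1
  convert! this using 1
  ext w
  simp only [pull_apply, Finset.sum_apply, Pi.mul_apply, sum_apply, smul_apply,
    ContinuousLinearMap.proj_apply, smul_eq_mul, ContinuousLinearMap.comp_apply,
    ContinuousLinearMap.coe_pi', Finset.sum_mul, Finset.mul_sum]
  rw [Finset.sum_comm]
  exact Finset.sum_congr rfl fun _ _ => Finset.sum_congr rfl fun _ _ => by ring

/-- By the sum and product rules, differentiability inside the algebra only has to be checked on
generators. -/
lemma exists_hasGrad_adjoin {W : Set (A → (ι → ℝ) → ℝ)}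
    (hW : ∀ w ∈ W, ∃ D : ι → A → (ι → ℝ) → ℝ, (∀ j, D j ∈ Algebra.adjoin ℝ W) ∧ HasGrad U w D)
    {f : A → (ι → ℝ) → ℝ} (hf : f ∈ Algebra.adjoin ℝ W) :
    ∃ D : ι → A → (ι → ℝ) → ℝ, (∀ j, D j ∈ Algebra.adjoin ℝ W) ∧ HasGrad U f D := by
  induction hf using Algebra.adjoin_induction with
  | mem x hx => exact hW x hx
  | algebraMap r => exact ⟨_, fun j => Subalgebra.zero_mem _, HasGrad.const fun _ => r⟩
  | add x y _ _ hx hy =>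
    obtain ⟨D, hD, hx⟩ := hx
    obtain ⟨E, hE, hy⟩ := hy
    exact ⟨_, fun j => Subalgebra.add_mem _ (hD j) (hE j), hx.add hy⟩
  | mul x y hx' hy' hx hy =>
    obtain ⟨D, hD, hx⟩ := hx
    obtain ⟨E, hE, hy⟩ := hy
    exact ⟨_, fun j => Subalgebra.add_mem _ (Subalgebra.mul_mem _ hx' (hE j))
      (Subalgebra.mul_mem _ hy' (hD j)), hx.mul hy⟩

/-- Composing a system with maps whose derivatives are polynomials in the resulting functions and
in finitely many further ones. -/
lemma IsGenSystem.pull_union {W : Set (A → (κ → ℝ) → ℝ)} (hW : IsGenSystem V W)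
    {h : κ → A → (ι → ℝ) → ℝ} (hh : ∀ i, PolyBdd U (h i))
    (hUV : ∀ a, ∀ v ∈ U, (fun i => h i a v) ∈ V) {D : κ → ι → A → (ι → ℝ) → ℝ}
    (hD : ∀ i, HasGrad U (h i) (D i)) {X : Set (A → (ι → ℝ) → ℝ)} (hX : X.Finite)
    (hXb : ∀ x ∈ X, PolyBdd U x)
    (hXg : ∀ x ∈ X, ∃ E : ι → A → (ι → ℝ) → ℝ,
      (∀ j, E j ∈ Algebra.adjoin ℝ (pull h '' W ∪ X)) ∧ HasGrad U x E)
    (hDX : ∀ i j, D i j ∈ Algebra.adjoin ℝ (pull h '' W ∪ X)) :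
    IsGenSystem U (pull h '' W ∪ X) where
  finite := (hW.finite.image _).union hX
  bdd := by
    rintro _ (⟨w, hw, rfl⟩ | hx)
    · exact (hW.bdd w hw).pull hh hUV
    · exact hXb _ hx
  grad := by
    rintro _ (⟨w, hw, rfl⟩ | hx)
    · obtain ⟨E, hE, hg⟩ := hW.grad w hw
      refine ⟨_, fun j => ?_, HasGrad.comp hD hUV hg⟩
      exact Subalgebra.sum_mem _ fun i _ => Subalgebra.mul_mem _
        (Algebra.adjoin_mono Set.subset_union_left (pull_mem_adjoin h (hE i))) (hDX i j)
    · exact hXg _ hx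

lemma IsGenSystem.iUnion {W : κ → Set (A → (ι → ℝ) → ℝ)} (hW : ∀ i, IsGenSystem U (W i)) :
    IsGenSystem U (⋃ i, W i) where
  finite := Set.finite_iUnion fun i => (hW i).finite
  bdd w hw := by
    obtain ⟨i, hi⟩ := Set.mem_iUnion.1 hw
    exact (hW i).bdd w hi
  grad w hw := by
    obtain ⟨i, hi⟩ := Set.mem_iUnion.1 hw
    obtain ⟨D, hD, h⟩ := (hW i).grad w hi
    exact ⟨D, fun j => Algebra.adjoin_mono (Set.subset_iUnion _ _) (hD j), h⟩

/-- The functions that are polynomials in a finite differential system with polynomial bounds. -/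
def IsGen (U : Set (ι → ℝ)) (f : A → (ι → ℝ) → ℝ) : Prop :=
  ∃ W, IsGenSystem U W ∧ f ∈ Algebra.adjoin ℝ W

lemma IsGen.exists_common {f : κ → A → (ι → ℝ) → ℝ} (hf : ∀ i, IsGen U (f i)) :
    ∃ W, IsGenSystem U W ∧ ∀ i, f i ∈ Algebra.adjoin ℝ W := by
  choose W hW hf using hf
  exact ⟨_, .iUnion hW, fun i => Algebra.adjoin_mono (Set.subset_iUnion _ _) (hf i)⟩

lemma IsGen.polyBdd {f : A → (ι → ℝ) → ℝ} (hf : IsGen U f) : PolyBdd U f := by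
  obtain ⟨W, hW, h⟩ := hf
  exact .adjoin hW.bdd h

/-- Both functions lie in the algebra of the union of their systems, so closure under every algebra
operation follows at once. -/
lemma IsGen.of_binary {f g k : A → (ι → ℝ) → ℝ} (hf : IsGen U f) (hg : IsGen U g)
    (h : ∀ S : Subalgebra ℝ (A → (ι → ℝ) → ℝ), f ∈ S → g ∈ S → k ∈ S) : IsGen U k := by
  obtain ⟨W, hW, h'⟩ := IsGen.exists_common (κ := Bool) (f := fun b => if b then f else g)
    (by rintro (_ | _) <;> simpa)
  exact ⟨W, hW, h _ (by simpa using h' true) (by simpa using h' false)⟩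

/-- The generated functions form an algebra. -/
def genAlg (A : Type*) (U : Set (ι → ℝ)) : Subalgebra ℝ (A → (ι → ℝ) → ℝ) where
  carrier := {f | IsGen U f}
  mul_mem' hf hg := IsGen.of_binary hf hg fun S => S.mul_mem
  add_mem' hf hg := IsGen.of_binary hf hg fun S => S.add_mem
  algebraMap_mem' r := ⟨∅, ⟨Set.finite_empty, by simp, by simp⟩, Subalgebra.algebraMap_mem _ r⟩

lemma IsGenSystem.isGen {W : Set (A → (ι → ℝ) → ℝ)} (hW : IsGenSystem U W) {w} (hw : w ∈ W) :
    IsGen U w := ⟨W, hW, Algebra.subset_adjoin hw⟩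

lemma isGen_const (c : ℝ) : IsGen U fun (_ : A) _ => c := (genAlg A U).algebraMap_mem c

lemma isGen_param {c : A → ℝ} (C : ℝ) (hc : ∀ a, |c a| ≤ C) : IsGen U fun a _ => c a := by
  refine IsGenSystem.isGen (W := {fun a _ => c a}) ⟨by simp, ?_, ?_⟩ (Set.mem_singleton _)
  · rintro _ rfl
    exact .of_abs_le C fun a _ _ => hc a
  · rintro _ rfl
    exact ⟨_, fun j => Subalgebra.zero_mem _, HasGrad.const c⟩

lemma isGen_coord (i : ι) : IsGen U fun (_ : A) v => v i := by
  classical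
  refine IsGenSystem.isGen (W := {fun _ v => v i}) ⟨by simp, ?_, ?_⟩ (Set.mem_singleton _)
  · rintro _ rfl
    refine ⟨1, 1, by simp, fun a v _ => ?_⟩
    have := norm_le_pi_norm v i
    rw [Real.norm_eq_abs] at this
    linarith
  · rintro _ rfl
    exact ⟨_, fun j => Subalgebra.algebraMap_mem _ _, HasGrad.coord i⟩

lemma IsGen.add {f g : A → (ι → ℝ) → ℝ} (hf : IsGen U f) (hg : IsGen U g) :
    IsGen U fun a v => f a v + g a v := (genAlg A U).add_mem hf hg

lemma IsGen.mul {f g : A → (ι → ℝ) → ℝ} (hf : IsGen U f) (hg : IsGen U g) :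
    IsGen U fun a v => f a v * g a v := (genAlg A U).mul_mem hf hg

lemma IsGen.sub {f g : A → (ι → ℝ) → ℝ} (hf : IsGen U f) (hg : IsGen U g) :
    IsGen U fun a v => f a v - g a v := (genAlg A U).sub_mem hf hg

lemma IsGen.neg {f : A → (ι → ℝ) → ℝ} (hf : IsGen U f) :
    IsGen U fun a v => - f a v := (genAlg A U).neg_mem hf

lemma IsGen.pow {f : A → (ι → ℝ) → ℝ} (hf : IsGen U f) (n : ℕ) :
    IsGen U fun a v => f a v ^ n := (genAlg A U).pow_mem hf n

lemma IsGen.sum {σ : Type*} (s : Finset σ) {f : σ → A → (ι → ℝ) → ℝ}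
    (hf : ∀ i ∈ s, IsGen U (f i)) : IsGen U fun a v => ∑ i ∈ s, f i a v := by
  have := (genAlg A U).sum_mem hf
  convert! this using 3
  simp

/-- The chain rule expresses the new derivatives through the pulled-back system of `f` and the
system of the inner maps, so the union of the two is again a system. -/
lemma IsGen.comp {f : A → (κ → ℝ) → ℝ} (hf : IsGen V f) {h : κ → A → (ι → ℝ) → ℝ}
    (hh : ∀ i, IsGen U (h i)) (hUV : ∀ a, ∀ v ∈ U, (fun i => h i a v) ∈ V) :
    IsGen U fun a v => f a fun i => h i a v := by
  obtain ⟨W, hW, hf⟩ := hf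
  obtain ⟨X, hX, hhX⟩ := IsGen.exists_common hh
  choose D hD hg using fun i => exists_hasGrad_adjoin hX.grad (hhX i)
  refine ⟨_, hW.pull_union (fun i => (hh i).polyBdd) hUV hg hX.finite hX.bdd (fun x hx => ?_)
    (fun i j => Algebra.adjoin_mono Set.subset_union_right (hD i j)), ?_⟩
  · obtain ⟨E, hE, h'⟩ := hX.grad x hx
    exact ⟨E, fun j => Algebra.adjoin_mono Set.subset_union_right (hE j), h'⟩
  · exact Algebra.adjoin_mono Set.subset_union_left (pull_mem_adjoin h hf)

end Gen

/-! ### Closure under elementary functions and under solving differential equations -/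

section Gen

variable {A ι κ : Type*} [Fintype ι] [Fintype κ] {U : Set (ι → ℝ)}

/-- A polynomially bounded function with generated partial derivatives is generated. -/
lemma IsGen.of_hasGrad {f : A → (ι → ℝ) → ℝ} (hb : PolyBdd U f) {D : ι → A → (ι → ℝ) → ℝ}
    (hf : HasGrad U f D) (hD : ∀ j, IsGen U (D j)) : IsGen U f := by
  obtain ⟨W, hW, hDW⟩ := IsGen.exists_common hD
  have hsub : W ⊆ insert f W := Set.subset_insert _ _
  refine IsGenSystem.isGen (W := insert f W) ⟨hW.finite.insert _, ?_, ?_⟩ (Set.mem_insert _ _)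
  · rintro _ (rfl | hw)
    exacts [hb, hW.bdd _ hw]
  · rintro _ (rfl | hw)
    · exact ⟨D, fun j => Algebra.adjoin_mono hsub (hDW j), hf⟩
    · obtain ⟨E, hE, h⟩ := hW.grad _ hw
      exact ⟨E, fun j => Algebra.adjoin_mono hsub (hE j), h⟩

/-- Adding a member of the algebra to a system. -/
lemma IsGenSystem.insert {W : Set (A → (ι → ℝ) → ℝ)} (hW : IsGenSystem U W)
    {f : A → (ι → ℝ) → ℝ} (hf : f ∈ Algebra.adjoin ℝ W) : IsGenSystem U (insert f W) := by
  have hsub : W ⊆ Insert.insert f W := Set.subset_insert _ _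
  refine ⟨hW.finite.insert _, ?_, ?_⟩
  · rintro _ (rfl | hw)
    exacts [.adjoin hW.bdd hf, hW.bdd _ hw]
  · have : ∀ w ∈ Algebra.adjoin ℝ W, ∃ D : ι → A → (ι → ℝ) → ℝ,
        (∀ j, D j ∈ Algebra.adjoin ℝ (Insert.insert f W)) ∧ HasGrad U w D := fun w hw => by
      obtain ⟨D, hD, h⟩ := exists_hasGrad_adjoin hW.grad hw
      exact ⟨D, fun j => Algebra.adjoin_mono hsub (hD j), h⟩
    rintro _ (rfl | hw)
    exacts [this _ hf, this _ (Algebra.subset_adjoin hw)]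

/-- Composition with a bounded function of one variable that belongs to a finite set closed under
differentiation. -/
lemma IsGen.unary {s : Set ℝ} {Ψ : Set (ℝ → ℝ)} (hfin : Ψ.Finite)
    (hb : ∀ ψ ∈ Ψ, ∃ C, ∀ x ∈ s, |ψ x| ≤ C)
    (hd : ∀ ψ ∈ Ψ, ∃ ψ' ∈ Algebra.adjoin ℝ Ψ, ∀ x ∈ s, HasDerivAt ψ (ψ' x) x)
    {ψ : ℝ → ℝ} (hψ : ψ ∈ Ψ) {f : A → (ι → ℝ) → ℝ} (hf : IsGen U f)
    (hs : ∀ a, ∀ v ∈ U, f a v ∈ s) : IsGen U fun a v => ψ (f a v) := by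
  let lift : (ℝ → ℝ) →ₐ[ℝ] (A → (Unit → ℝ) → ℝ) :=
    { toFun := fun ψ _ v => ψ (v ())
      map_one' := rfl
      map_mul' := fun _ _ => rfl
      map_zero' := rfl
      map_add' := fun _ _ => rfl
      commutes' := fun _ => rfl }
  have hW : IsGenSystem (A := A) {v : Unit → ℝ | v () ∈ s} (lift '' Ψ) := by
    refine ⟨hfin.image _, ?_, ?_⟩
    · rintro _ ⟨ψ, hψ, rfl⟩
      obtain ⟨C, hC⟩ := hb ψ hψ
      exact .of_abs_le C fun a v hv => hC _ hv
    · rintro _ ⟨ψ, hψ, rfl⟩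
      obtain ⟨ψ', h1, h2⟩ := hd ψ hψ
      refine ⟨fun _ => lift ψ', fun _ => ?_, fun a v hv => ?_⟩
      · rw [← AlgHom.map_adjoin]
        exact Subalgebra.mem_map.2 ⟨ψ', h1, rfl⟩
      · have h3 := (h2 _ hv).comp_hasFDerivAt v (hasFDerivAt_apply (𝕜 := ℝ) (F' := fun _ => ℝ) () v)
        simpa using! h3
  exact (hW.isGen ⟨ψ, hψ, rfl⟩).comp (h := fun _ => f) (fun _ => hf) hs

lemma IsGen.sin {f : A → (ι → ℝ) → ℝ} (hf : IsGen U f) : IsGen U fun a v => Real.sin (f a v) := by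
  refine hf.unary (s := Set.univ) (Ψ := {Real.sin, Real.cos}) (by simp) ?_ ?_ (by simp) (by simp)
  · rintro _ (rfl | rfl)
    exacts [⟨1, fun x _ => Real.abs_sin_le_one x⟩, ⟨1, fun x _ => Real.abs_cos_le_one x⟩]
  · rintro _ (rfl | rfl)
    · exact ⟨_, Algebra.subset_adjoin (by simp), fun x _ => Real.hasDerivAt_sin x⟩
    · exact ⟨_, Subalgebra.neg_mem _ (Algebra.subset_adjoin (a := Real.sin) (by simp)),
        fun x _ => Real.hasDerivAt_cos x⟩

lemma IsGen.cos {f : A → (ι → ℝ) → ℝ} (hf : IsGen U f) : IsGen U fun a v => Real.cos (f a v) := by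
  simpa only [Real.sin_add_pi_div_two] using (hf.add (isGen_const (Real.pi / 2))).sin

lemma IsGen.sigmoid {f : A → (ι → ℝ) → ℝ} (hf : IsGen U f) :
    IsGen U fun a v => Real.sigmoid (f a v) := by
  refine hf.unary (s := Set.univ) (Ψ := {Real.sigmoid}) (by simp) ?_ ?_ (by simp) (by simp)
  · rintro _ rfl
    exact ⟨1, fun x _ => abs_le.2 ⟨by linarith [Real.sigmoid_pos x], Real.sigmoid_le_one x⟩⟩
  · rintro _ rfl
    have h : Real.sigmoid ∈ Algebra.adjoin ℝ {Real.sigmoid} := Algebra.subset_adjoin (by simp)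
    exact ⟨_, Subalgebra.mul_mem _ h (Subalgebra.sub_mem _ (Subalgebra.one_mem _) h),
      fun x _ => Real.hasDerivAt_sigmoid x⟩

lemma IsGen.inv {f : A → (ι → ℝ) → ℝ} (hf : IsGen U f) (h1 : ∀ a, ∀ v ∈ U, 1 ≤ f a v) :
    IsGen U fun a v => (f a v)⁻¹ := by
  refine hf.unary (s := Set.Ici 1) (Ψ := {fun x => x⁻¹}) (by simp) ?_ ?_ rfl h1
  · rintro _ rfl
    refine ⟨1, fun x hx => ?_⟩
    have hx : (1 : ℝ) ≤ x := hx
    rw [abs_of_nonneg (by positivity)]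
    exact inv_le_one_of_one_le₀ hx
  · rintro _ rfl
    have h : (fun x : ℝ => x⁻¹) ∈ Algebra.adjoin ℝ {fun x : ℝ => x⁻¹} :=
      Algebra.subset_adjoin (by simp)
    refine ⟨_, Subalgebra.neg_mem _ (Subalgebra.pow_mem _ h 2), fun x hx => ?_⟩
    have hx : (1 : ℝ) ≤ x := hx
    simpa using! hasDerivAt_inv (by positivity : x ≠ 0)

/-- The square root is unbounded, so `1 / √x` is used instead: it is bounded on `[1, ∞)` and its
derivative is a multiple of its own cube. Then `√x = x * (1 / √x)`. -/
lemma IsGen.sqrt {f : A → (ι → ℝ) → ℝ} (hf : IsGen U f) (h1 : ∀ a, ∀ v ∈ U, 1 ≤ f a v) :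
    IsGen U fun a v => √(f a v) := by
  have key : IsGen U fun a v => (√(f a v))⁻¹ := by
    refine hf.unary (s := Set.Ici 1) (Ψ := {fun x => (√x)⁻¹}) (by simp) ?_ ?_ rfl h1
    · rintro _ rfl
      refine ⟨1, fun x hx => ?_⟩
      rw [abs_of_nonneg (by positivity)]
      exact inv_le_one_of_one_le₀ (Real.one_le_sqrt.2 hx)
    · rintro _ rfl
      have h : (fun x : ℝ => (√x)⁻¹) ∈ Algebra.adjoin ℝ {fun x : ℝ => (√x)⁻¹} :=
        Algebra.subset_adjoin (by simp)
      refine ⟨_, Subalgebra.smul_mem _ (Subalgebra.pow_mem _ h 3) (-(1 / 2)), fun x hx => ?_⟩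
      have hx : (1 : ℝ) ≤ x := hx
      have hs : 0 < √x := Real.sqrt_pos.2 (by linarith)
      have := (Real.hasDerivAt_sqrt (by linarith : x ≠ 0)).inv hs.ne'
      convert! this using 1
      simp
      field_simp
  simpa only [← div_eq_mul_inv, Real.div_sqrt] using hf.mul key

lemma IsGen.arctan {f : A → (ι → ℝ) → ℝ} (hf : IsGen U f) :
    IsGen U fun a v => Real.arctan (f a v) := by
  have key : IsGen (A := A) (Set.univ : Set (Unit → ℝ)) fun _ v => Real.arctan (v ()) := by
    refine IsGen.of_hasGrad (D := fun _ _ v => (1 + v () ^ 2)⁻¹) (.of_abs_le (Real.pi / 2) ?_) ?_ ?_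
    · exact fun _ v _ => abs_le.2 ⟨(Real.neg_pi_div_two_lt_arctan _).le,
        (Real.arctan_lt_pi_div_two _).le⟩
    · intro a v _
      have h3 := (Real.hasDerivAt_arctan (v ())).comp_hasFDerivAt v
        (hasFDerivAt_apply (𝕜 := ℝ) (F' := fun _ => ℝ) () v)
      simpa using! h3
    · exact fun _ => ((isGen_const 1).add ((isGen_coord ()).pow 2)).inv
        fun a v _ => by nlinarith [sq_nonneg (v ())]
  exact key.comp (h := fun _ => f) (fun _ => hf) (fun _ _ _ => trivial)

/-- Solutions of differential equations with generated right-hand side are generated. -/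
lemma IsGen.of_ode {t₀ B : ℝ} {V : Set (Option κ → ℝ)} {Φ : κ → A → (Option κ → ℝ) → ℝ}
    (hΦ : ∀ i, IsGen V (Φ i)) {Y : A → ℝ → κ → ℝ}
    (hV : ∀ a, ∀ t > t₀, (fun o : Option κ => o.elim t (Y a t)) ∈ V)
    (hY : ∀ a, ∀ t > t₀, HasDerivAt (Y a) (fun i => Φ i a fun o => o.elim t (Y a t)) t)
    (hB : ∀ a, ∀ t > t₀, ‖Y a t‖ ≤ B) (i : κ) :
    IsGen {v : Unit → ℝ | t₀ < v ()} fun a v => Y a (v ()) i := by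
  classical
  let h : Option κ → A → (Unit → ℝ) → ℝ := fun o a v => o.elim (v ()) (Y a (v ()))
  -- The coordinates are added to the system of `Φ` so that their pullbacks are the components of
  -- `Y` themselves.
  obtain ⟨W, hW, hmem⟩ := IsGen.exists_common (κ := κ ⊕ κ)
    (f := Sum.elim Φ fun i _ v => v (some i))
    (U := V) (by rintro (i | i); exacts [hΦ i, isGen_coord _])
  have hval : ∀ (a : A) (v : Unit → ℝ), (fun o : Option κ => o.elim (v ()) (Y a (v ()))) =
      fun o => h o a v := fun _ _ => rfl
  let D : Option κ → Unit → A → (Unit → ℝ) → ℝ := fun o _ => o.elim 1 fun i => pull h (Φ i)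
  have hD : ∀ o, HasGrad {v : Unit → ℝ | t₀ < v ()} (h o) (D o) := by
    rintro (_ | i)
    · have := HasGrad.coord (A := A) (U := {v : Unit → ℝ | t₀ < v ()}) ()
      simpa [h, D] using! this
    · intro a v hv
      have h3 := (hasDerivAt_pi.1 (hY a _ hv) i).comp_hasFDerivAt v
        (hasFDerivAt_apply (𝕜 := ℝ) (F' := fun _ => ℝ) () v)
      simpa using! h3
  have hpoly : ∀ o, PolyBdd {v : Unit → ℝ | t₀ < v ()} (h o) := by
    rintro (_ | i)
    · exact (isGen_coord ()).polyBdd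
    · exact .of_abs_le B fun a v hv => (norm_le_pi_norm (Y a (v ())) i).trans (hB a _ hv)
  -- Time is adjoined as a further function, with derivative `1`, which makes the system autonomous.
  refine ⟨_, hW.pull_union (h := h) (D := D) (X := {fun _ v => v ()}) hpoly
    (fun a v hv => hV a _ hv) hD (by simp) ?_ ?_ ?_, ?_⟩
  · rintro _ rfl
    exact (isGen_coord ()).polyBdd
  · rintro _ rfl
    exact ⟨_, fun _ => Subalgebra.algebraMap_mem _ _, HasGrad.coord ()⟩
  · rintro (_ | i) j
    · exact Subalgebra.one_mem _
    · exact Algebra.adjoin_mono Set.subset_union_left (pull_mem_adjoin h (hmem (Sum.inl i)))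
  · exact Algebra.adjoin_mono Set.subset_union_left (pull_mem_adjoin h (hmem (Sum.inr i)))

end Gen

/-! ## Generated functions are in the space-bounded class -/

lemma GSpace.of_fintype {κ : Type*} [Fintype κ] {J : Set ℝ} (hJ : J.Nonempty)
    (P : κ → MvPolynomial κ ℝ) (z : ℝ → κ → ℝ)
    (hz : ∀ t ∈ J, ∀ i, HasDerivAt (fun t => z t i) (MvPolynomial.eval (z t) (P i)) t) (i₀ : κ)
    {s : ℝ → ℝ} (hs : ∀ t ∈ J, ∀ i, |z t i| ≤ s t) : GSpace J (fun t => z t i₀) s := by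
  classical
  obtain ⟨t₀, ht₀⟩ := hJ
  obtain ⟨n, hn⟩ : ∃ n, Fintype.card κ = n + 1 :=
    Nat.exists_eq_succ_of_ne_zero (Fintype.card_pos_iff.2 ⟨i₀⟩).ne'
  let e₁ := Fintype.equivFinOfCardEq hn
  -- The swap moves the chosen component to index `0`, where `GSpace` reads its output.
  let e : κ ≃ Fin (n + 1) := e₁.trans (Equiv.swap (e₁ i₀) 0)
  have he : e.symm 0 = i₀ := by rw [Equiv.symm_apply_eq]; simp [e]
  refine ⟨n, fun i => MvPolynomial.rename e (P (e.symm i)), t₀, _, fun t i => z t (e.symm i), ht₀,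
    rfl, fun t ht => hasDerivAt_pi.2 fun i => ?_, fun t ht => ⟨by simp only [he], ?_⟩⟩
  · rw [MvPolynomial.eval_rename]
    convert! hz t ht (e.symm i) using 3
    ext k
    simp
  · exact (pi_norm_le_iff_of_nonneg ((abs_nonneg _).trans (hs t ht i₀))).2 fun i => hs t ht _

theorem IsGen.gSpaceMulti {A : Type*} {d : ℕ} {U : Set (Fin (d + 1) → ℝ)}
    {F : A → (Fin (d + 1) → ℝ) → ℝ} (hF : IsGen U F) :
    ∃ (C : ℝ) (p : ℕ), 0 ≤ C ∧ ∀ C' ≥ C, ∀ p' ≥ p, ∀ a,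
      GSpaceMulti U (F a) fun v => C' * (1 + v 0) ^ p' := by
  classical
  obtain ⟨W₀, hW₀, hFW⟩ := hF
  -- `F` has to be an actual component of the final system, not merely a polynomial in the
  -- components.
  have hW := hW₀.insert hFW
  set W := insert F W₀
  have hFW : F ∈ W := Set.mem_insert _ _
  have : Fintype W := hW.finite.fintype
  choose C p hC hb using fun w : W => (hW.bdd w w.2).exists_ge
  choose D hD hg using fun w : W => hW.grad w w.2
  have hQ : ∀ w j, ∃ Q : MvPolynomial W ℝ, MvPolynomial.aeval (fun x : W => x.1) Q = D w j := by
    intro w j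
    have := hD w j
    rw [Algebra.adjoin_eq_range] at this
    exact this
  choose Q hQ using hQ
  refine ⟨∑ w, C w, ∑ w, p w, Finset.sum_nonneg fun w _ => hC w, fun C' hC' p' hp' a J hJ _ g
    sg hgs hgU => ?_⟩
  choose n P t₀ y₀ y ht₀ hy₀ hy hb' using hgs
  have hgy : ∀ t ∈ J, ∀ i, g t i = y i t 0 := fun t ht i => (hb' i t ht).1
  -- The joint state: the values of all members of `W` along `g`, together with the systems that
  -- generate the components of `g`.
  let z : ℝ → (W ⊕ (Σ i, Fin (n i + 1))) → ℝ :=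
    fun t => Sum.elim (fun w => w.1 a (g t)) fun q => y q.1 t q.2
  have hgd : ∀ t ∈ J, HasDerivAt g (fun i => MvPolynomial.eval (y i t) (P i 0)) t := fun t ht => by
    refine hasDerivAt_pi.2 fun i => ?_
    refine (hasDerivAt_pi.1 (hy i t ht) 0).congr_of_eventuallyEq ?_
    filter_upwards [hJ.mem_nhds ht] with t ht using hgy t ht i
  have hyb : ∀ t ∈ J, ∀ i j, |y i t j| ≤ sg t := fun t ht i j =>
    (norm_le_pi_norm (y i t) j).trans (hb' i t ht).2
  refine GSpace.of_fintype (κ := W ⊕ (Σ i, Fin (n i + 1))) ⟨t₀ 0, ht₀ 0⟩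
    (Sum.elim
      (fun w => ∑ j, MvPolynomial.rename Sum.inl (Q w j) *
        MvPolynomial.rename (fun k => Sum.inr ⟨j, k⟩) (P j 0))
      fun q => MvPolynomial.rename (fun k => Sum.inr ⟨q.1, k⟩) (P q.1 q.2))
    z ?_ (Sum.inl ⟨F, hFW⟩) ?_
  · rintro t ht (w | ⟨i, j⟩)
    · have h1 := (hg w a (g t) (hgU t ht)).comp_hasDerivAt t (hgd t ht)
      convert! h1 using 1
      simp only [Sum.elim_inl, map_sum, map_mul, MvPolynomial.eval_rename, sum_apply, smul_apply,
        ContinuousLinearMap.proj_apply, smul_eq_mul]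
      refine Finset.sum_congr rfl fun j _ => ?_
      congr 1
      -- Evaluation at `(a, g t)` is an algebra homomorphism, so it turns the identity `hQ` between
      -- functions into a polynomial identity in the state.
      let ev : (A → (Fin (d + 1) → ℝ) → ℝ) →ₐ[ℝ] ℝ :=
        (Pi.evalAlgHom ℝ (fun _ => ℝ) (g t)).comp (Pi.evalAlgHom ℝ (fun _ => _) a)
      have h2 : D w j a (g t) = ev (D w j) := rfl
      rw [h2, ← hQ w j, ← AlgHom.comp_apply, MvPolynomial.comp_aeval,
        ← MvPolynomial.coe_aeval_eq_eval]
      rfl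
    · simpa [MvPolynomial.eval_rename] using! hasDerivAt_pi.1 (hy i t ht) j
  · have hg0 : ∀ t ∈ J, ‖g t‖ ≤ sg t := fun t ht => by
      refine (pi_norm_le_iff_of_nonneg ((abs_nonneg _).trans (hyb t ht 0 0))).2 fun i => ?_
      rw [hgy t ht i]
      exact hyb t ht i 0
    rintro t ht (w | ⟨i, j⟩)
    · refine le_max_of_le_right ?_
      refine hb w C' ?_ p' ?_ a (g t) (hgU t ht) _ (hg0 t ht)
      · exact (Finset.single_le_sum (fun w _ => hC w) (Finset.mem_univ w)).trans hC'
      · exact (Finset.single_le_sum (fun w _ => Nat.zero_le (p w)) (Finset.mem_univ w)).trans hp'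
    · exact le_max_of_le_left (hyb t ht i j)

/-! ## Differential equations in an invariant box -/

section Box

variable {κ : Type*} [Fintype κ]

/-- After the last time at which `u ≤ B`, the function is above `B` and hence nonincreasing, so it
cannot get above `B` at all. -/
lemma le_of_deriv_nonpos_of_ge {u u' : ℝ → ℝ} {t₀ T B : ℝ}
    (hu : ∀ t ∈ Set.Icc t₀ T, HasDerivWithinAt u (u' t) (Set.Icc t₀ T) t) (h0 : u t₀ ≤ B)
    (h : ∀ t ∈ Set.Icc t₀ T, B ≤ u t → u' t ≤ 0) : ∀ t ∈ Set.Icc t₀ T, u t ≤ B := by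
  intro t₁ ht₁
  by_contra! hB
  have hc : ContinuousOn u (Set.Icc t₀ T) := fun t ht => (hu t ht).continuousWithinAt
  have hsub : Set.Icc t₀ t₁ ⊆ Set.Icc t₀ T := Set.Icc_subset_Icc_right ht₁.2
  have hS : IsCompact (Set.Icc t₀ t₁ ∩ u ⁻¹' Set.Iic B) :=
    isCompact_Icc.of_isClosed_subset
      ((hc.mono hsub).preimage_isClosed_of_isClosed isClosed_Icc isClosed_Iic)
      Set.inter_subset_left
  obtain ⟨t₂, ⟨ht₂, hut₂⟩, hmax⟩ := hS.exists_isGreatest ⟨t₀, ⟨le_rfl, ht₁.1⟩, h0⟩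
  have hut₂ : u t₂ ≤ B := hut₂
  have hsub2 : Set.Icc t₂ t₁ ⊆ Set.Icc t₀ T := Set.Icc_subset_Icc ht₂.1 ht₁.2
  have hanti : AntitoneOn u (Set.Icc t₂ t₁) := by
    refine antitoneOn_of_hasDerivWithinAt_nonpos (convex_Icc _ _) (hc.mono hsub2)
      (f' := u') (fun t ht => ?_) fun t ht => ?_
    · exact (hu t (hsub2 (interior_subset ht))).mono (interior_subset.trans hsub2)
    · rw [interior_Icc] at ht
      refine h t (hsub2 (Set.Ioo_subset_Icc_self ht)) ?_
      by_contra! hlt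
      exact absurd (hmax ⟨⟨ht₂.1.trans ht.1.le, ht.2.le⟩, hlt.le⟩) (not_le.2 ht.1)
  have := hanti ⟨le_rfl, ht₂.2⟩ ⟨ht₂.2, le_rfl⟩ ht₂.2
  linarith

variable {Φ : ℝ → (κ → ℝ) → κ → ℝ} {t₀ B : ℝ}

/-- The projection to the box `[-B, B]^κ`. -/
noncomputable def clamp (B : ℝ) (Y : κ → ℝ) : κ → ℝ := fun i => max (-B) (min B (Y i))

lemma clamp_mem (hB : 0 ≤ B) (Y : κ → ℝ) : clamp B Y ∈ Metric.closedBall 0 B := by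
  rw [mem_closedBall_zero_iff, pi_norm_le_iff_of_nonneg hB]
  exact fun i => abs_le.2 ⟨le_max_left _ _, max_le (by linarith) (min_le_left _ _)⟩

lemma clamp_lipschitz : LipschitzWith 1 (clamp (κ := κ) B) := by
  refine LipschitzWith.of_dist_le_mul fun x y => ?_
  rw [NNReal.coe_one, one_mul]
  refine (dist_pi_le_iff dist_nonneg).2 fun i => le_trans ?_ (dist_le_pi_dist x y i)
  have := ((LipschitzWith.id (α := ℝ)).const_min B).const_max (-B)
  simpa [clamp] using this.dist_le_mul (x i) (y i)

omit [Fintype κ] in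
lemma clamp_of_abs_le {Y : κ → ℝ} (h : ∀ i, |Y i| ≤ B) : clamp B Y = Y := by
  ext i
  have := abs_le.1 (h i)
  simp [clamp, this.1, this.2]

lemma exists_box_solution_Icc (hB : 0 ≤ B) {T : ℝ} (hT : t₀ ≤ T)
    (hLip : ∃ K, ∀ t ∈ Set.Icc t₀ T, LipschitzOnWith K (Φ t) (Metric.closedBall 0 B))
    (hc : ∀ Y ∈ Metric.closedBall (0 : κ → ℝ) B, ContinuousOn (Φ · Y) (Set.Icc t₀ T))
    (hup : ∀ t ∈ Set.Icc t₀ T, ∀ Y, ‖Y‖ ≤ B → ∀ i, Y i = B → Φ t Y i ≤ 0)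
    (hlo : ∀ t ∈ Set.Icc t₀ T, ∀ Y, ‖Y‖ ≤ B → ∀ i, Y i = -B → 0 ≤ Φ t Y i)
    {Y₀ : κ → ℝ} (hY₀ : ‖Y₀‖ ≤ B) :
    ∃ Y : ℝ → κ → ℝ, Y t₀ = Y₀ ∧
      (∀ t ∈ Set.Icc t₀ T, HasDerivWithinAt Y (Φ t (Y t)) (Set.Icc t₀ T) t) ∧
      ∀ t ∈ Set.Icc t₀ T, ‖Y t‖ ≤ B := by
  obtain ⟨K, hK⟩ := hLip
  have h0 : (0 : κ → ℝ) ∈ Metric.closedBall (0 : κ → ℝ) B := by simpa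
  obtain ⟨L₀, hL₀⟩ := isCompact_Icc.exists_bound_of_continuousOn (hc 0 h0)
  have hL : ∀ t ∈ Set.Icc t₀ T, ∀ Y : κ → ℝ, ‖Φ t (clamp B Y)‖ ≤ |L₀| + K * B := by
    intro t ht Y
    have h1 := (hK t ht).dist_le_mul _ (clamp_mem hB Y) _ h0
    have h2 : ‖clamp B Y‖ ≤ B := by simpa using clamp_mem hB Y
    rw [dist_eq_norm, dist_zero_right] at h1
    have h3 := norm_le_insert' (Φ t (clamp B Y)) (Φ t 0)
    have h4 : (K : ℝ) * ‖clamp B Y‖ ≤ K * B := by gcongr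
    linarith [hL₀ t ht, le_abs_self L₀]
  let L : NNReal := ⟨|L₀| + K * B, by positivity⟩
  -- The clamped field is bounded by `L` on the whole space, so with this radius the Picard–Lindelöf
  -- condition holds on all of `[t₀, T]`.
  let a : NNReal := L * ⟨T - t₀, by linarith⟩
  have hPL : IsPicardLindelof (fun t Y => Φ t (clamp B Y)) (⟨t₀, le_rfl, hT⟩ : Set.Icc t₀ T) Y₀
      a 0 L K := by
    refine ⟨fun t ht => ?_, fun x _ => hc _ (clamp_mem hB x), fun t ht x _ => hL t ht x, ?_⟩
    · have := (hK t ht).comp (clamp_lipschitz (B := B) |>.lipschitzOnWith (s := Set.univ))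
        (fun Y _ => clamp_mem hB Y)
      rw [mul_one] at this
      exact this.mono (Set.subset_univ _)
    · rw [NNReal.coe_zero, sub_zero, max_eq_left (by simpa using hT)]
      exact le_of_eq rfl
  obtain ⟨Y, hY0, hY⟩ := hPL.exists_eq_forall_mem_Icc_hasDerivWithinAt₀
  have hYi : ∀ i, ∀ t ∈ Set.Icc t₀ T,
      HasDerivWithinAt (fun t => Y t i) (Φ t (clamp B (Y t)) i) (Set.Icc t₀ T) t :=
    fun i t ht => hasDerivWithinAt_pi.1 (hY t ht) i
  have hb0 : ∀ i, |Y t₀ i| ≤ B := fun i => by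
    rw [show Y t₀ = Y₀ from hY0]; exact (norm_le_pi_norm Y₀ i).trans hY₀
  -- Where `Y t i ≥ B`, the clamped point lies on the face with `i`-th coordinate `B`, and there the
  -- field points inward. Hence the solution never leaves the box, and clamping was harmless.
  have hle : ∀ i, ∀ t ∈ Set.Icc t₀ T, Y t i ≤ B := fun i =>
    le_of_deriv_nonpos_of_ge (hYi i) (abs_le.1 (hb0 i)).2 fun t ht h => by
      refine hup t ht _ (by simpa using clamp_mem hB (Y t)) i ?_
      simp only [clamp, min_eq_left h]
      exact max_eq_right (by linarith)
  have hge : ∀ i, ∀ t ∈ Set.Icc t₀ T, -Y t i ≤ B := fun i =>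
    le_of_deriv_nonpos_of_ge (fun t ht => (hYi i t ht).neg) (by linarith [(abs_le.1 (hb0 i)).1])
      fun t ht h => by
        refine neg_nonpos.2 (hlo t ht _ (by simpa using clamp_mem hB (Y t)) i ?_)
        simp only [clamp]
        exact max_eq_left ((min_le_right _ _).trans (by linarith))
  have habs : ∀ t ∈ Set.Icc t₀ T, ∀ i, |Y t i| ≤ B := fun t ht i =>
    abs_le.2 ⟨by linarith [hge i t ht], hle i t ht⟩
  refine ⟨Y, hY0, fun t ht => ?_, fun t ht => (pi_norm_le_iff_of_nonneg hB).2 (habs t ht)⟩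
  simpa only [clamp_of_abs_le (habs t ht)] using hY t ht

/-- A field that points into the box on its boundary has global forward solutions in the box. -/
theorem exists_box_solution (hB : 0 ≤ B)
    (hLip : ∀ T, ∃ K, ∀ t ∈ Set.Icc t₀ T, LipschitzOnWith K (Φ t) (Metric.closedBall 0 B))
    (hc : ∀ Y ∈ Metric.closedBall (0 : κ → ℝ) B, ContinuousOn (Φ · Y) (Set.Ici t₀))
    (hup : ∀ t ≥ t₀, ∀ Y, ‖Y‖ ≤ B → ∀ i, Y i = B → Φ t Y i ≤ 0)
    (hlo : ∀ t ≥ t₀, ∀ Y, ‖Y‖ ≤ B → ∀ i, Y i = -B → 0 ≤ Φ t Y i)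
    {Y₀ : κ → ℝ} (hY₀ : ‖Y₀‖ ≤ B) :
    ∃ Y : ℝ → κ → ℝ, (∀ t > t₀, HasDerivAt Y (Φ t (Y t)) t) ∧ ∀ t ≥ t₀, ‖Y t‖ ≤ B := by
  have hex := fun n : ℕ => exists_box_solution_Icc hB (T := t₀ + n) (by simp) (hLip _)
    (fun Y hY => (hc Y hY).mono Set.Icc_subset_Ici_self) (fun t ht => hup t ht.1)
    (fun t ht => hlo t ht.1) hY₀
  choose Z hZ0 hZ hZB using hex
  -- By uniqueness, solutions on longer intervals extend those on shorter ones; the global solution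
  -- uses the interval of length `⌈t - t₀⌉₊`.
  have hagree : ∀ m n : ℕ, m ≤ n → Set.EqOn (Z m) (Z n) (Set.Icc t₀ (t₀ + m)) := by
    intro m n hmn
    have hsub : Set.Icc t₀ (t₀ + m) ⊆ Set.Icc t₀ (t₀ + n) :=
      Set.Icc_subset_Icc_right (by gcongr)
    obtain ⟨K, hK⟩ := hLip (t₀ + m)
    have hI : ∀ {t : ℝ}, t ∈ Set.Ico t₀ (t₀ + m) → ∀ {l : ℕ}, m ≤ l →
        HasDerivWithinAt (Z l) (Φ t (Z l t)) (Set.Ici t) t := fun {t} ht {l} hl => by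
      have hl' : (m : ℝ) ≤ l := by exact_mod_cast hl
      refine ((hZ l t ⟨ht.1, by linarith [ht.2]⟩).mono_of_mem_nhdsWithin ?_)
      exact Filter.mem_of_superset (Icc_mem_nhdsGE (by linarith [ht.2] : t < t₀ + l))
        (Set.Icc_subset_Icc_left ht.1)
    refine ODE_solution_unique_of_mem_Icc_right (s := fun _ => Metric.closedBall 0 B) (v := Φ)
      (fun t ht => hK t ⟨ht.1, ht.2.le⟩)
      (fun t ht => (hZ m t ht).continuousWithinAt) (fun t ht => hI ht le_rfl)
      (fun t ht => by simpa using hZB m t ⟨ht.1, ht.2.le⟩)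
      (fun t ht => ((hZ n t (hsub ht)).continuousWithinAt).mono hsub) (fun t ht => hI ht hmn)
      (fun t ht => by simpa using hZB n t (hsub ⟨ht.1, ht.2.le⟩)) ?_
    rw [hZ0, hZ0]
  have hmem : ∀ t ≥ t₀, t ∈ Set.Icc t₀ (t₀ + ⌈t - t₀⌉₊) := fun t ht =>
    ⟨ht, by linarith [Nat.le_ceil (t - t₀)]⟩
  have hYeq : ∀ (n : ℕ), ∀ t ∈ Set.Icc t₀ (t₀ + n), Z ⌈t - t₀⌉₊ t = Z n t := fun n t ht =>
    hagree _ _ (Nat.ceil_le.2 (by linarith [ht.2])) (hmem t ht.1)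
  refine ⟨fun t => Z ⌈t - t₀⌉₊ t, fun t ht => ?_, fun t ht => hZB _ t (hmem t ht)⟩
  obtain ⟨n, hn⟩ := exists_nat_gt (t - t₀)
  have hnh : Set.Icc t₀ (t₀ + n) ∈ nhds t := Icc_mem_nhds ht (by linarith)
  have h1 := (hZ n t ⟨ht.le, by linarith⟩).hasDerivAt hnh
  have h2 : (fun t => Z ⌈t - t₀⌉₊ t) =ᶠ[nhds t] Z n :=
    Filter.eventually_of_mem hnh fun s hs => hYeq n s hs
  have h3 := h1.congr_of_eventuallyEq h2
  rwa [← h2.self_of_nhds] at h3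

end Box

/-! ### Box solutions for generated fields -/

/-- Generated functions are Lipschitz on bounded convex sets. -/
lemma IsGen.exists_lipschitzOnWith {A ι : Type*} [Fintype ι] {U S : Set (ι → ℝ)}
    {f : A → (ι → ℝ) → ℝ} (hf : IsGen U f) (hS : Convex ℝ S) (hSU : S ⊆ U) {R : ℝ}
    (hR : ∀ v ∈ S, ‖v‖ ≤ R) : ∃ K, ∀ a, LipschitzOnWith K (f a) S := by
  obtain ⟨W, hW, hfW⟩ := hf
  obtain ⟨D, hD, hg⟩ := exists_hasGrad_adjoin hW.grad hfW
  choose C p hC hb using fun j => PolyBdd.adjoin hW.bdd (hD j)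
  rcases S.eq_empty_or_nonempty with rfl | ⟨v₀, hv₀⟩
  · exact ⟨0, fun a => by simp⟩
  have hR0 : 0 ≤ R := (norm_nonneg _).trans (hR v₀ hv₀)
  have hpos : ∀ j, 0 ≤ C j * (1 + R) ^ p j := fun j => mul_nonneg (hC j) (by positivity)
  refine ⟨⟨∑ j, C j * (1 + R) ^ p j, Finset.sum_nonneg fun j _ => hpos j⟩, fun a => ?_⟩
  refine hS.lipschitzOnWith_of_nnnorm_hasFDerivWithin_le
    (fun v hv => (hg a v (hSU hv)).hasFDerivWithinAt) fun v hv => ?_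
  change ‖(∑ j, D j a v • (ContinuousLinearMap.proj j : (ι → ℝ) →L[ℝ] ℝ))‖ ≤
    ∑ j, C j * (1 + R) ^ p j
  refine (norm_sum_le _ _).trans (Finset.sum_le_sum fun j _ => ?_)
  rw [norm_smul]
  have h1 : ‖(ContinuousLinearMap.proj j : (ι → ℝ) →L[ℝ] ℝ)‖ ≤ 1 :=
    ContinuousLinearMap.opNorm_le_bound _ zero_le_one fun w => by
      simpa using norm_le_pi_norm w j
  calc ‖D j a v‖ * _ ≤ (C j * (1 + R) ^ p j) * 1 := by
        refine mul_le_mul ((hb j a v (hSU hv)).trans ?_) h1 (norm_nonneg _) (hpos j)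
        have := hR v hv
        have := hC j
        gcongr
    _ = _ := mul_one _

section Box

variable {A κ : Type*} [Fintype κ]

/-- A point of space-time. -/
def timeCons {κ : Type*} (t : ℝ) (Y : κ → ℝ) : Option κ → ℝ := fun o => o.elim t Y

/-- Generated fields that point into a box on its boundary have generated solutions. -/
theorem IsGen.exists_box_solution {t₀ t₁ B : ℝ} (ht : t₁ < t₀) (hB : 0 ≤ B)
    {Φ : κ → A → (Option κ → ℝ) → ℝ} (hΦ : ∀ i, IsGen {v | t₁ < v none} (Φ i))
    (hup : ∀ a, ∀ t ≥ t₀, ∀ Y, ‖Y‖ ≤ B → ∀ i, Y i = B → Φ i a (timeCons t Y) ≤ 0)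
    (hlo : ∀ a, ∀ t ≥ t₀, ∀ Y, ‖Y‖ ≤ B → ∀ i, Y i = -B → 0 ≤ Φ i a (timeCons t Y)) :
    ∃ Y : A → ℝ → κ → ℝ,
      (∀ a, ∀ t > t₀, HasDerivAt (Y a) (fun i => Φ i a (timeCons t (Y a t))) t) ∧
      (∀ a, ∀ t ≥ t₀, ‖Y a t‖ ≤ B) ∧
      ∀ i, IsGen {v : Unit → ℝ | t₀ < v ()} fun a v => Y a (v ()) i := by
  let S : ℝ → Set (Option κ → ℝ) := fun T =>
    {v | v none ∈ Set.Icc t₀ T ∧ ∀ i, v (some i) ∈ Set.Icc (-B) B}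
  have hSc : ∀ T, Convex ℝ (S T) := fun T => by
    have h1 : S T = (Set.univ : Set (Option κ)).pi
        fun o => o.elim (Set.Icc t₀ T) fun _ => Set.Icc (-B) B := by
      ext v
      simp [S, Set.mem_pi, Option.forall]
    rw [h1]
    refine convex_pi fun o _ => ?_
    cases o <;> exact convex_Icc _ _
  have hSB : ∀ T, ∀ v ∈ S T, ‖v‖ ≤ |t₀| + |T| + B := fun T v hv => by
    refine (pi_norm_le_iff_of_nonneg (by positivity)).2 ?_
    rintro (_ | i)
    · have := hv.1
      exact abs_le.2 ⟨by linarith [neg_abs_le t₀, this.1, abs_nonneg T],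
        by linarith [le_abs_self T, this.2, abs_nonneg t₀]⟩
    · have := abs_le.2 (hv.2 i)
      rw [Real.norm_eq_abs]
      linarith [abs_nonneg t₀, abs_nonneg T]
  have hK : ∀ T i, ∃ K, ∀ a, LipschitzOnWith K (Φ i a) (S T) := fun T i =>
    (hΦ i).exists_lipschitzOnWith (hSc T) (fun v hv => lt_of_lt_of_le ht hv.1.1) (hSB T)
  choose K hK using hK
  have hmem : ∀ {T t : ℝ} {Y : κ → ℝ}, t ∈ Set.Icc t₀ T → Y ∈ Metric.closedBall 0 B →
      timeCons t Y ∈ S T := fun ht hY => ⟨ht, fun i => abs_le.1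
        ((norm_le_pi_norm _ i).trans (mem_closedBall_zero_iff.1 hY))⟩
  have hex : ∀ a, ∃ Y : ℝ → κ → ℝ,
      (∀ t > t₀, HasDerivAt Y (fun i => Φ i a (timeCons t (Y t))) t) ∧ ∀ t ≥ t₀, ‖Y t‖ ≤ B := by
    intro a
    -- The start `0` is an arbitrary point of the box; nothing is claimed about the initial value,
    -- which later resets wipe out.
    refine GPAC.exists_box_solution (Φ := fun t Y i => Φ i a (timeCons t Y)) hB
      (fun T => ⟨∑ i, K T i, fun t ht => ?_⟩)
      (fun Y hY => continuousOn_pi.2 fun i t ht => ?_) (hup a) (hlo a) (Y₀ := 0) (by simpa)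
    · refine LipschitzOnWith.of_dist_le_mul fun Y hY Y' hY' => ?_
      refine (dist_pi_le_iff (by positivity)).2 fun i => ?_
      refine ((hK T i a).dist_le_mul _ (hmem ht hY) _ (hmem ht hY')).trans ?_
      refine mul_le_mul ?_ ?_ dist_nonneg (by positivity)
      · exact_mod_cast Finset.single_le_sum (f := K T) (fun i _ => by positivity)
          (Finset.mem_univ i)
      · refine (dist_pi_le_iff dist_nonneg).2 ?_
        rintro (_ | i)
        · simp [timeCons]
        · exact dist_le_pi_dist Y Y' i
    · have h1 : ContinuousOn (fun t => Φ i a (timeCons t Y)) (Set.Icc t₀ (t + 1)) := by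
        refine (hK (t + 1) i a).continuousOn.comp ?_ fun s hs => hmem hs hY
        refine (continuous_pi ?_).continuousOn
        rintro (_ | j)
        · exact continuous_id
        · exact continuous_const
      have ht : t₀ ≤ t := ht
      refine (h1 t ⟨ht, by linarith⟩).mono_of_mem_nhdsWithin ?_
      rw [← Set.Ici_inter_Iic, Set.inter_comm]
      exact Filter.inter_mem (mem_nhdsWithin_of_mem_nhds (Iic_mem_nhds (by linarith)))
        self_mem_nhdsWithin
  choose Y hY hYB using hex
  exact ⟨Y, hY, hYB, IsGen.of_ode hΦ (fun a t h => ht.trans h) hY fun a t ht => hYB a t ht.le⟩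

end Box

/-! ## Scalar estimates -/

/-- While `a ≥ l`, the integrating factor `exp (l (t - s))` keeps the excess over `p + δ` decaying.
Between `e₁` and `e` only `a ≥ 0` is known, which still prevents `u` from rising above the level
reached. -/
lemma tracking_one_sided {u a g : ℝ → ℝ} {s e₁ e p δ R l : ℝ} (h1 : s ≤ e₁) (h2 : e₁ ≤ e)
    (hu : ∀ t ∈ Set.Icc s e, HasDerivAt u (a t * (g t - u t)) t)
    (ha : ∀ t ∈ Set.Icc s e, 0 ≤ a t) (hal : ∀ t ∈ Set.Icc s e₁, l ≤ a t)
    (hg : ∀ t ∈ Set.Icc s e, g t ≤ p + δ) (hR : 0 ≤ R) (hδ : 0 ≤ δ) (hs : u s - p ≤ R) :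
    u e - p ≤ δ + R * Real.exp (-(l * (e₁ - s))) := by
  have hv : (u e₁ - p - δ) * Real.exp (l * (e₁ - s)) ≤ R := by
    refine le_of_deriv_nonpos_of_ge (u := fun t => (u t - p - δ) * Real.exp (l * (t - s)))
      (u' := fun t => a t * (g t - u t) * Real.exp (l * (t - s)) +
        (u t - p - δ) * (Real.exp (l * (t - s)) * l))
      (t₀ := s) (T := e₁) (fun t ht => ?_) (by simp; linarith) (fun t ht h => ?_) e₁ ⟨h1, le_rfl⟩
    · have hd : HasDerivAt (fun t => l * (t - s)) l t := by
        simpa using ((hasDerivAt_id t).sub_const s).const_mul l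
      exact ((((hu t ⟨ht.1, ht.2.trans h2⟩).sub_const p).sub_const δ).mul hd.exp).hasDerivWithinAt
    · have he := Real.exp_pos (l * (t - s))
      have h3 : 0 ≤ u t - p - δ := by
        by_contra! hneg
        have := mul_neg_of_neg_of_pos hneg he
        linarith
      have h4 := hg t ⟨ht.1, ht.2.trans h2⟩
      have h5 := hal t ht
      have h6 := ha t ⟨ht.1, ht.2.trans h2⟩
      have h7 : a t * (g t - u t) + (u t - p - δ) * l ≤ 0 := by
        nlinarith [mul_nonneg h6 (by linarith : 0 ≤ p + δ - g t), mul_nonneg h3 (sub_nonneg.2 h5)]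
      nlinarith
  have hE := Real.exp_pos (-(l * (e₁ - s)))
  have hu1 : u e₁ ≤ p + (δ + R * Real.exp (-(l * (e₁ - s)))) := by
    have h := mul_le_mul_of_nonneg_right hv hE.le
    rw [mul_assoc, ← Real.exp_add, add_neg_cancel, Real.exp_zero, mul_one] at h
    linarith
  have hfin := le_of_deriv_nonpos_of_ge (u := u) (u' := fun t => a t * (g t - u t)) (t₀ := e₁)
    (T := e) (fun t ht => (hu t ⟨h1.trans ht.1, ht.2⟩).hasDerivWithinAt) hu1
    (fun t ht h => by
      refine mul_nonpos_of_nonneg_of_nonpos (ha t ⟨h1.trans ht.1, ht.2⟩) ?_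
      have := hg t ⟨h1.trans ht.1, ht.2⟩
      nlinarith [mul_nonneg hR hE.le]) e ⟨h2, le_rfl⟩
  linarith

/-- A solution of `u' = a (g - u)` approaches `p` when `g` stays close to `p`. -/
lemma tracking {u a g : ℝ → ℝ} {s e₁ e p δ R l : ℝ} (h1 : s ≤ e₁) (h2 : e₁ ≤ e)
    (hu : ∀ t ∈ Set.Icc s e, HasDerivAt u (a t * (g t - u t)) t)
    (ha : ∀ t ∈ Set.Icc s e, 0 ≤ a t) (hal : ∀ t ∈ Set.Icc s e₁, l ≤ a t)
    (hg : ∀ t ∈ Set.Icc s e, |g t - p| ≤ δ) (hs : |u s - p| ≤ R) :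
    |u e - p| ≤ δ + R * Real.exp (-(l * (e₁ - s))) := by
  have hR := (abs_nonneg _).trans hs
  have hδ := (abs_nonneg _).trans (hg s ⟨le_rfl, h1.trans h2⟩)
  have h3 := tracking_one_sided h1 h2 hu ha hal (p := p) (δ := δ)
    (fun t ht => by linarith [(abs_le.1 (hg t ht)).2]) hR hδ (abs_le.1 hs).2
  have h4 := tracking_one_sided (u := fun t => -u t) (a := a) (g := fun t => -g t) (p := -p)
    (δ := δ) h1 h2
    (fun t ht => by convert! (hu t ht).neg using 1; ring) ha hal
    (fun t ht => by linarith [(abs_le.1 (hg t ht)).1]) hR hδ (by linarith [(abs_le.1 hs).1])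
  exact abs_le.2 ⟨by linarith, h3⟩

/-- A solution of `u' = a (g - u)` hardly moves while `a` is small. -/
lemma holding {u a g : ℝ → ℝ} {s e c : ℝ}
    (hu : ∀ t ∈ Set.Icc s e, HasDerivAt u (a t * (g t - u t)) t)
    (hc : ∀ t ∈ Set.Icc s e, |a t * (g t - u t)| ≤ c) {t : ℝ} (ht : t ∈ Set.Icc s e) :
    |u t - u s| ≤ c * (t - s) := by
  have h := (convex_Icc s e).norm_image_sub_le_of_norm_hasDerivWithin_le
    (fun t ht => (hu t ht).hasDerivWithinAt) hc ⟨le_rfl, ht.1.trans ht.2⟩ ht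
  rwa [Real.norm_eq_abs, Real.norm_eq_abs, abs_of_nonneg (sub_nonneg.2 ht.1)] at h

lemma sigmoid_le_exp (x : ℝ) : Real.sigmoid x ≤ Real.exp x := by
  rw [Real.sigmoid_def, ← neg_neg x, Real.exp_neg (-x), neg_neg]
  exact inv_anti₀ (Real.exp_pos _) (by linarith)

lemma sigmoid_le_exp_of_le {x y : ℝ} (h : x ≤ y) : Real.sigmoid x ≤ Real.exp y :=
  (sigmoid_le_exp x).trans (Real.exp_le_exp.2 h)

lemma one_sub_sigmoid_le_exp_of_le {x y : ℝ} (h : -x ≤ y) : 1 - Real.sigmoid x ≤ Real.exp y := by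
  rw [← Real.sigmoid_neg]
  exact sigmoid_le_exp_of_le h

lemma cos_two_pi_nonneg {t : ℝ} {j : ℕ} (h : |t - j| ≤ 1 / 4) :
    0 ≤ Real.cos (2 * Real.pi * t) := by
  have h1 : 2 * Real.pi * t = 2 * Real.pi * (t - j) + j * (2 * Real.pi) := by ring
  rw [h1, Real.cos_add_nat_mul_two_pi]
  obtain ⟨h2, h3⟩ := abs_le.1 h
  have := Real.pi_pos
  exact Real.cos_nonneg_of_neg_pi_div_two_le_of_le (by nlinarith) (by nlinarith)

lemma half_le_cos_two_pi {t : ℝ} {j : ℕ} (h : |t - j| ≤ 1 / 6) :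
    1 / 2 ≤ Real.cos (2 * Real.pi * t) := by
  have h1 : 2 * Real.pi * t = 2 * Real.pi * (t - j) + j * (2 * Real.pi) := by ring
  rw [h1, Real.cos_add_nat_mul_two_pi, ← Real.cos_abs, ← Real.cos_pi_div_three]
  have := Real.pi_pos
  rw [abs_mul, abs_of_pos (by positivity)]
  exact Real.cos_le_cos_of_nonneg_of_le_pi (by positivity) (by linarith) (by nlinarith)

lemma cos_two_pi_nonpos {t : ℝ} {j : ℕ} (h : |t - (j + 1 / 2)| ≤ 1 / 4) :
    Real.cos (2 * Real.pi * t) ≤ 0 := by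
  have h1 : 2 * Real.pi * t = 2 * Real.pi * (t - 1 / 2) + Real.pi := by ring
  rw [h1, Real.cos_add_pi]
  have := cos_two_pi_nonneg (t := t - 1 / 2) (j := j) (by convert h using 2; ring)
  linarith

lemma cos_two_pi_le_neg_half {t : ℝ} {j : ℕ} (h : |t - (j + 1 / 2)| ≤ 1 / 6) :
    Real.cos (2 * Real.pi * t) ≤ -(1 / 2) := by
  have h1 : 2 * Real.pi * t = 2 * Real.pi * (t - 1 / 2) + Real.pi := by ring
  rw [h1, Real.cos_add_pi]
  have := half_le_cos_two_pi (t := t - 1 / 2) (j := j) (by convert h using 2; ring)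
  linarith

lemma le_sin_pi_mul {x d : ℝ} (h1 : d ≤ x) (h2 : x ≤ 1 - d) (hd : 0 ≤ d) :
    2 * d ≤ Real.sin (Real.pi * x) := by
  have hp := Real.pi_pos
  rcases le_total x (1 / 2) with h | h
  · have := Real.mul_le_sin (x := Real.pi * x) (by nlinarith) (by nlinarith)
    have h3 : 2 / Real.pi * (Real.pi * x) = 2 * x := by field_simp
    linarith
  · have := Real.mul_le_sin (x := Real.pi * (1 - x)) (by nlinarith) (by nlinarith)
    have h3 : 2 / Real.pi * (Real.pi * (1 - x)) = 2 * (1 - x) := by field_simp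
    rw [mul_sub, mul_one, Real.sin_pi_sub] at this
    linarith [mul_sub Real.pi 1 x]

/-- Away from the squares, `sin (π √t)` has the sign `(-1) ^ ⌊√t⌋` and is not too small. -/
lemma le_sin_pi_sqrt {t : ℝ} {M : ℕ} (hM : 1 ≤ M) (h1 : (M : ℝ) ^ 2 + 1 / 4 ≤ t)
    (h2 : t ≤ (M + 1 : ℝ) ^ 2 - 1 / 4) :
    1 ≤ 6 * √t * ((-1) ^ M * Real.sin (Real.pi * √t)) := by
  have hM1 : (1 : ℝ) ≤ M := by exact_mod_cast hM
  have ht : 0 ≤ t := by nlinarith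
  have hw := Real.sq_sqrt ht
  have hMw : (M : ℝ) ≤ √t := Real.le_sqrt_of_sq_le (by linarith)
  set w := √t
  have hw0 : 0 < w := by linarith
  -- Both distances come from a difference of squares of at least `1/4`: the other factor is `w + M
  -- ≤ 2w` here and `M + 1 + w ≤ 3w` below, where `M ≥ 1` is used.
  have hd1 : 1 / (12 * w) ≤ w - M := by
    rw [div_le_iff₀ (by positivity)]
    nlinarith
  have hd2 : w - M ≤ 1 - 1 / (12 * w) := by
    have h3 : w ≤ M + 1 := by nlinarith
    have : 1 / (12 * w) ≤ M + 1 - w := by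
      rw [div_le_iff₀ (by positivity)]
      nlinarith
    linarith
  have h3 := le_sin_pi_mul hd1 hd2 (by positivity)
  have h4 : Real.sin (Real.pi * w) = (-1) ^ M * Real.sin (Real.pi * (w - M)) := by
    rw [← Real.sin_add_nat_mul_pi]
    congr 1
    ring
  rw [h4, ← mul_assoc ((-1 : ℝ) ^ M), ← mul_pow, neg_one_mul, neg_neg, one_pow, one_mul]
  calc (1 : ℝ) = 6 * w * (2 * (1 / (12 * w))) := by field_simp; norm_num
    _ ≤ _ := by gcongr

/-! ## Iterating a map by a differential equation -/

/-- The clock: large while `s cos (2πt) ≥ 1/2`, tiny while `s cos (2πt) ≤ 0`. -/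
noncomputable def drive (s t : ℝ) : ℝ :=
  12 * t * Real.sigmoid (12 * t * (s * Real.cos (2 * Real.pi * t) - 1 / 2))

/-- The reset signal: close to `1` while `⌊√t⌋` is even, close to `0` while it is odd. -/
noncomputable def resetSignal (t : ℝ) : ℝ :=
  Real.sigmoid (6 * √t * (12 * t) * Real.sin (Real.pi * √t))

lemma drive_nonneg {s t : ℝ} (ht : 0 ≤ t) : 0 ≤ drive s t :=
  mul_nonneg (by linarith) (Real.sigmoid_nonneg _)

/-- The sigmoid is at most `exp (-6t)`. Half of the retained `exp (-2t)` absorbs the prefactor `t`,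
the other half remains. -/
lemma drive_le {s t : ℝ} (ht : 0 ≤ t) (h : s * Real.cos (2 * Real.pi * t) ≤ 0) :
    drive s t ≤ 12 * Real.exp (-t) := by
  have h1 : Real.sigmoid (12 * t * (s * Real.cos (2 * Real.pi * t) - 1 / 2)) ≤
      Real.exp (-t + -t) := sigmoid_le_exp_of_le (by nlinarith)
  have h2 : t ≤ Real.exp t := by linarith [Real.add_one_le_exp t]
  calc drive s t ≤ 12 * Real.exp t * Real.exp (-t + -t) :=
        mul_le_mul (by linarith) h1 (Real.sigmoid_nonneg _) (by positivity)
    _ = _ := by rw [mul_assoc, ← Real.exp_add]; ring_nf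

lemma le_drive {s t : ℝ} (ht : 0 ≤ t) (h : 1 / 2 ≤ s * Real.cos (2 * Real.pi * t)) :
    6 * t ≤ drive s t := by
  have h1 : (2 : ℝ)⁻¹ ≤ Real.sigmoid (12 * t * (s * Real.cos (2 * Real.pi * t) - 1 / 2)) := by
    rw [← Real.sigmoid_zero]
    exact Real.sigmoid_le (mul_nonneg (by linarith) (by linarith))
  unfold drive
  nlinarith

lemma resetSignal_le {t : ℝ} {M : ℕ} (hM : Odd M) (h1 : (M : ℝ) ^ 2 + 1 / 4 ≤ t)
    (h2 : t ≤ (M + 1 : ℝ) ^ 2 - 1 / 4) : resetSignal t ≤ Real.exp (-t) := by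
  have ht : 0 ≤ t := by nlinarith
  refine sigmoid_le_exp_of_le ?_
  have := le_sin_pi_sqrt hM.pos h1 h2
  rw [hM.neg_one_pow] at this
  nlinarith

lemma one_sub_resetSignal_le {t : ℝ} {M : ℕ} (hM1 : 1 ≤ M) (hM : Even M)
    (h1 : (M : ℝ) ^ 2 + 1 / 4 ≤ t) (h2 : t ≤ (M + 1 : ℝ) ^ 2 - 1 / 4) :
    1 - resetSignal t ≤ Real.exp (-t) := by
  have ht : 0 ≤ t := by nlinarith
  refine one_sub_sigmoid_le_exp_of_le ?_
  have := le_sin_pi_sqrt hM1 h1 h2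
  rw [hM.neg_one_pow] at this
  nlinarith

lemma resetSignal_nonneg (t : ℝ) : 0 ≤ resetSignal t := Real.sigmoid_nonneg _

lemma resetSignal_le_one (t : ℝ) : resetSignal t ≤ 1 := Real.sigmoid_le_one _

lemma abs_sub_le_two_mul {x y B : ℝ} (hx : |x| ≤ B) (hy : |y| ≤ B) : |x - y| ≤ 2 * B :=
  (abs_sub _ _).trans (by linarith)

/-- One half-cycle of the clock followed by one half-cycle of rest. -/
lemma drive_cycle {u g a : ℝ → ℝ} {c p δ B : ℝ} (hc : 0 ≤ c)
    (hu : ∀ t ∈ Set.Icc c (c + 1), HasDerivAt u (a t * (g t - u t)) t)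
    (ha : ∀ t ∈ Set.Icc c (c + 1), 0 ≤ a t)
    (hal : ∀ t ∈ Set.Icc (c + 1 / 12) (c + 5 / 12), 6 * t ≤ a t)
    (has : ∀ t ∈ Set.Icc (c + 1 / 2) (c + 1), a t ≤ 12 * Real.exp (-t))
    (huB : ∀ t ∈ Set.Icc c (c + 1), |u t| ≤ B) (hgB : ∀ t ∈ Set.Icc c (c + 1), |g t| ≤ B)
    (hp : |p| ≤ B) (hg : ∀ t ∈ Set.Icc c (c + 1 / 2), |g t - p| ≤ δ) :
    ∀ t ∈ Set.Icc (c + 1 / 2) (c + 1), |u t - p| ≤ δ + 14 * B * Real.exp (-c) := by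
  intro t ht
  have hB : 0 ≤ B := (abs_nonneg _).trans hp
  have hsub1 : Set.Icc (c + 1 / 12) (c + 1 / 2) ⊆ Set.Icc c (c + 1) :=
    Set.Icc_subset_Icc (by linarith) (by linarith)
  have hsub2 : Set.Icc (c + 1 / 2) (c + 1) ⊆ Set.Icc c (c + 1) :=
    Set.Icc_subset_Icc (by linarith) (by linarith)
  -- On the window of length `1/3` the rate is at least `6c`, so the initial distance `2B` shrinks
  -- by `exp (-2c)`. The drift during rest adds `12B exp (-c)`, which gives the total `14B`.
  have h1 := tracking (s := c + 1 / 12) (e₁ := c + 5 / 12) (e := c + 1 / 2) (l := 6 * c) (p := p)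
    (by linarith) (by linarith) (fun t ht => hu t (hsub1 ht)) (fun t ht => ha t (hsub1 ht))
    (fun t ht => by linarith [hal t ht, ht.1])
    (fun t ht => hg t ⟨by linarith [ht.1], ht.2⟩)
    (abs_sub_le_two_mul (huB _ ⟨by linarith, by linarith⟩) hp)
  have h2 : Real.exp (-(6 * c * (c + 5 / 12 - (c + 1 / 12)))) ≤ Real.exp (-c) :=
    Real.exp_le_exp.2 (by linarith)
  have h3 := holding (fun t ht => hu t (hsub2 ht)) (c := 12 * Real.exp (-c) * (2 * B))
    (fun t ht => by
      have h4 := abs_sub_le_two_mul (hgB t (hsub2 ht)) (huB t (hsub2 ht))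
      have h5 : Real.exp (-t) ≤ Real.exp (-c) := Real.exp_le_exp.2 (by linarith [ht.1])
      rw [abs_mul, abs_of_nonneg (ha t (hsub2 ht))]
      exact mul_le_mul (by linarith [has t ht]) h4 (abs_nonneg _) (by positivity)) ht
  have h6 : 12 * Real.exp (-c) * (2 * B) * (t - (c + 1 / 2)) ≤
      12 * Real.exp (-c) * (2 * B) * (1 / 2) := by
    gcongr
    linarith [ht.2]
  have h7 : 2 * B * Real.exp (-(6 * c * (c + 5 / 12 - (c + 1 / 12)))) ≤ 2 * B * Real.exp (-c) := by
    gcongr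
  have h8 := abs_sub_le (u t) (u (c + 1 / 2)) p
  linarith

/-- With sign `-1` the clock is active around half-integers, here `j + 1/2`; the result is then held
around `j + 1`. -/
lemma compute_cycle {u g : ℝ → ℝ} {j : ℕ} {p δ B : ℝ}
    (hu : ∀ t ∈ Set.Icc (j + 1 / 4 : ℝ) (j + 5 / 4), HasDerivAt u (drive (-1) t * (g t - u t)) t)
    (huB : ∀ t ∈ Set.Icc (j + 1 / 4 : ℝ) (j + 5 / 4), |u t| ≤ B)
    (hgB : ∀ t ∈ Set.Icc (j + 1 / 4 : ℝ) (j + 5 / 4), |g t| ≤ B) (hp : |p| ≤ B)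
    (hg : ∀ t ∈ Set.Icc (j + 1 / 4 : ℝ) (j + 3 / 4), |g t - p| ≤ δ) {t : ℝ}
    (ht : |t - (j + 1 : ℕ)| ≤ 1 / 4) : |u t - p| ≤ δ + 14 * B * Real.exp (-j) := by
  have hj : (0 : ℝ) ≤ j := Nat.cast_nonneg j
  have hB : 0 ≤ B := (abs_nonneg _).trans hp
  have e1 : (j : ℝ) + 5 / 4 = j + 1 / 4 + 1 := by ring
  have e2 : (j : ℝ) + 3 / 4 = j + 1 / 4 + 1 / 2 := by ring
  rw [e1] at hu huB hgB
  rw [e2] at hg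
  push_cast at ht
  have ht' := abs_le.1 ht
  have := drive_cycle (by linarith) hu (fun t ht => drive_nonneg (by linarith [ht.1]))
    (fun t ht => le_drive (by linarith [ht.1]) ?_) (fun t ht => drive_le (by linarith [ht.1]) ?_)
    huB hgB hp hg t ⟨by linarith, by linarith⟩
  · refine this.trans ?_
    have : Real.exp (-(j + 1 / 4 : ℝ)) ≤ Real.exp (-j) := Real.exp_le_exp.2 (by linarith)
    gcongr
  · have := cos_two_pi_le_neg_half (t := t) (j := j)
      (abs_le.2 ⟨by linarith [ht.1], by linarith [ht.2]⟩)
    linarith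
  · have := cos_two_pi_nonneg (t := t) (j := j + 1)
      (abs_le.2 ⟨by push_cast; linarith [ht.1], by push_cast; linarith [ht.2]⟩)
    linarith

/-- With sign `1` the clock is active around the integer `j`; the copy is held around `j + 1/2`,
exactly while the next value is being computed from it. -/
lemma copy_cycle {u g : ℝ → ℝ} {j : ℕ} {p δ B : ℝ} (hj : 1 ≤ j)
    (hu : ∀ t ∈ Set.Icc (j - 1 / 4 : ℝ) (j + 3 / 4), HasDerivAt u (drive 1 t * (g t - u t)) t)
    (huB : ∀ t ∈ Set.Icc (j - 1 / 4 : ℝ) (j + 3 / 4), |u t| ≤ B)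
    (hgB : ∀ t ∈ Set.Icc (j - 1 / 4 : ℝ) (j + 3 / 4), |g t| ≤ B) (hp : |p| ≤ B)
    (hg : ∀ t : ℝ, |t - j| ≤ 1 / 4 → |g t - p| ≤ δ) :
    ∀ t ∈ Set.Icc (j + 1 / 4 : ℝ) (j + 3 / 4), |u t - p| ≤ δ + 14 * B * Real.exp (-(j - 1)) := by
  intro t ht
  have hj : (1 : ℝ) ≤ j := by exact_mod_cast hj
  have hB : 0 ≤ B := (abs_nonneg _).trans hp
  have e1 : (j : ℝ) + 3 / 4 = j - 1 / 4 + 1 := by ring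
  have e2 : (j : ℝ) + 1 / 4 = j - 1 / 4 + 1 / 2 := by ring
  rw [e1] at hu huB hgB
  rw [e1, e2] at ht
  have := drive_cycle (by linarith) hu (fun t ht => drive_nonneg (by linarith [ht.1]))
    (fun t ht => le_drive (by linarith [ht.1]) ?_) (fun t ht => drive_le (by linarith [ht.1]) ?_)
    huB hgB hp (fun t ht => hg t (abs_le.2 ⟨by linarith [ht.1], by linarith [ht.2]⟩)) t ht
  · refine this.trans ?_
    have : Real.exp (-(j - 1 / 4 : ℝ)) ≤ Real.exp (-(j - 1)) := Real.exp_le_exp.2 (by linarith)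
    gcongr
  · have := half_le_cos_two_pi (t := t) (j := j)
      (abs_le.2 ⟨by linarith [ht.1], by linarith [ht.2]⟩)
    linarith
  · have := cos_two_pi_nonpos (t := t) (j := j)
      (abs_le.2 ⟨by linarith [ht.1], by linarith [ht.2]⟩)
    linarith

/-- Induction on `n` inside one run. In `D`, the term `14KB` is the copying error amplified by the
map, `C` is the gate error, and `16B` consists of `2B` for leakage of the reset signal and `14B` for
the computing cycle. -/
lemma iteration_bound {κ : Type*} {B η K C : ℝ} {F : ℝ → (κ → ℝ) → κ → ℝ} {V : ℕ → κ → ℝ}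
    {y z : ℝ → κ → ℝ} (hK : 1 ≤ K) (hC : 0 ≤ C)
    (hy : ∀ t > 2, ∀ i, HasDerivAt (fun t => y t i) (drive (-1) t *
      ((1 - resetSignal t) * F t (z t) i + resetSignal t * V 0 i - y t i)) t)
    (hz : ∀ t > 2, ∀ i, HasDerivAt (fun t => z t i) (drive 1 t * (y t i - z t i)) t)
    (hyB : ∀ t > 2, ∀ i, |y t i| ≤ B) (hzB : ∀ t > 2, ∀ i, |z t i| ≤ B)
    (hFB : ∀ t > 2, ∀ i, |F t (z t) i| ≤ B) (hV : ∀ n i, |V n i| ≤ B)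
    (hstep : ∀ t > 2, ∀ n x, ∀ e ≤ η, (∀ i, |x i - V n i| ≤ e) →
      ∀ i, |F t x i - V (n + 1) i| ≤ K * e + C * Real.exp (-t))
    {M : ℕ} (hM : Odd M) (hM2 : 2 ≤ M)
    (hMη : (2 * K) ^ M * (2 * (14 * K * B + C + 16 * B)) * Real.exp (-((M : ℝ) ^ 2 - 1)) ≤ η)
    (n : ℕ) (hn : n ≤ M) (t : ℝ) (ht : |t - (M ^ 2 + n : ℕ)| ≤ 1 / 4) (i : κ) :
    |y t i - V n i| ≤
      (2 * K) ^ n * (14 * K * B + C + 16 * B) * Real.exp (-((M : ℝ) ^ 2 - 1)) := by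
  have hB : 0 ≤ B := (abs_nonneg _).trans (hV 0 i)
  have hM2' : (2 : ℝ) ≤ M := by exact_mod_cast hM2
  set D := 14 * K * B + C + 16 * B with hD
  set ε := Real.exp (-((M : ℝ) ^ 2 - 1)) with hε
  have hε0 : 0 < ε := Real.exp_pos _
  have hKB : B ≤ K * B := le_mul_of_one_le_left hB hK
  have hD0 : 0 ≤ D := by positivity
  have hGB : ∀ t > 2, ∀ i, |(1 - resetSignal t) * F t (z t) i + resetSignal t * V 0 i| ≤ B := by
    intro t ht i
    have h1 := resetSignal_nonneg t
    have h2 := resetSignal_le_one t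
    have h3 := abs_le.1 (hFB t ht i)
    have h4 := abs_le.1 (hV 0 i)
    exact abs_le.2 ⟨by nlinarith, by nlinarith⟩
  induction n generalizing t i with
  | zero =>
    obtain ⟨j, hj⟩ : ∃ j, M ^ 2 = j + 1 :=
      Nat.exists_eq_succ_of_ne_zero (by positivity)
    have hj' : (M : ℝ) ^ 2 = j + 1 := by exact_mod_cast hj
    have hj2 : (3 : ℝ) ≤ j := by nlinarith
    -- The cycle just before time `M ^ 2` belongs to the even phase of `M' = M - 1`, so it drives
    -- `y` to `V 0`. It starts near `M ^ 2 - 1`, whence the exponent in `ε`.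
    obtain ⟨M', rfl⟩ : ∃ M', M = M' + 1 := Nat.exists_eq_succ_of_ne_zero (by omega)
    have hM' : Even M' := by simpa [Nat.odd_add_one] using hM
    have hje : ε = Real.exp (-j) := by rw [hε, hj']; ring_nf
    push_cast at hj'
    have hM1 : (1 : ℝ) ≤ M' := by exact_mod_cast (by omega : 1 ≤ M')
    have := compute_cycle (j := j) (p := V 0 i) (δ := 2 * B * ε)
      (fun t ht => hy t (by linarith [ht.1]) i)
      (fun t ht => hyB t (by linarith [ht.1]) i) (fun t ht => hGB t (by linarith [ht.1]) i)
      (hV 0 i) (fun t ht => ?_) (t := t) (by rw [add_zero, hj] at ht; exact ht)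
    · rw [← hje] at this
      rw [pow_zero, one_mul]
      nlinarith [mul_nonneg hC hε0.le, mul_nonneg hB hε0.le,
        mul_nonneg (mul_nonneg (zero_le_one.trans hK) hB) hε0.le]
    · have h1 := one_sub_resetSignal_le (t := t) (by omega) hM'
        (by nlinarith [ht.1]) (by nlinarith [ht.2])
      have h2 : Real.exp (-t) ≤ ε := by
        rw [hje]; exact Real.exp_le_exp.2 (by linarith [ht.1])
      have h3 := abs_sub_le_two_mul (hFB t (by linarith [ht.1]) i) (hV 0 i)
      have h4 := resetSignal_le_one t
      have h5 : (1 - resetSignal t) * F t (z t) i + resetSignal t * V 0 i - V 0 i =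
        (1 - resetSignal t) * (F t (z t) i - V 0 i) := by ring
      rw [h5, abs_mul, abs_of_nonneg (by linarith), mul_comm (2 * B)]
      exact mul_le_mul (h1.trans h2) h3 (abs_nonneg _) hε0.le
  | succ n ih =>
    have hnM : ((n : ℝ) + 1) ≤ M := by exact_mod_cast hn
    have ih := ih (by omega)
    set E := (2 * K) ^ n * D * ε with hE
    set j := M ^ 2 + n with hj
    have hjr : (j : ℝ) = (M : ℝ) ^ 2 + n := by rw [hj]; push_cast; rfl
    have hn0 : (0 : ℝ) ≤ n := Nat.cast_nonneg n
    have hj4 : (4 : ℝ) ≤ j := by nlinarith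
    have hεj : Real.exp (-(j - 1 : ℝ)) ≤ ε := Real.exp_le_exp.2 (by linarith)
    have hεt : ∀ t : ℝ, (j : ℝ) ≤ t → Real.exp (-t) ≤ ε := fun t ht =>
      Real.exp_le_exp.2 (by linarith)
    have hE0 : 0 ≤ E := by positivity
    have hz' : ∀ t ∈ Set.Icc (j + 1 / 4 : ℝ) (j + 3 / 4), ∀ i,
        |z t i - V n i| ≤ E + 14 * B * ε := by
      intro t ht i
      refine (copy_cycle (j := j) (p := V n i) (δ := E) (B := B) (by rw [hj]; nlinarith)
        (fun t ht => hz t (by linarith [ht.1]) i)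
        (fun t ht => hzB t (by linarith [ht.1]) i) (fun t ht => hyB t (by linarith [ht.1]) i)
        (hV n i) (fun t ht => ih t ht i) t ht).trans ?_
      gcongr
    have hpow : (2 * K) ^ n ≤ (2 * K) ^ M := pow_le_pow_right₀ (by linarith) (by omega)
    have hpow1 : 1 ≤ (2 * K) ^ n := one_le_pow₀ (by linarith)
    have hDE : D * ε ≤ E := by
      rw [hE, mul_assoc]
      exact le_mul_of_one_le_left (by positivity) hpow1
    have h14 : 14 * B * ε ≤ D * ε := by
      refine mul_le_mul_of_nonneg_right ?_ hε0.le
      nlinarith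
    -- This keeps `z` within the radius in which the map is known to be accurate; the factor `2` in
    -- `hMη` pays for the copying error.
    have hη : E + 14 * B * ε ≤ η := by
      refine le_trans ?_ hMη
      have : E ≤ (2 * K) ^ M * D * ε := by rw [hE]; gcongr
      linarith
    have hδ : ∀ t ∈ Set.Icc (j + 1 / 4 : ℝ) (j + 3 / 4),
        |(1 - resetSignal t) * F t (z t) i + resetSignal t * V 0 i - V (n + 1) i| ≤
          K * (E + 14 * B * ε) + C * ε + 2 * B * ε := by
      intro t ht
      have h1 := hstep t (by linarith [ht.1]) n (z t) _ hη (hz' t ht) i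
      have h2 := resetSignal_le (t := t) hM (by linarith [ht.1]) (by nlinarith [ht.2])
      have h3 := resetSignal_nonneg t
      have h4 := abs_sub_le_two_mul (hV 0 i) (hV (n + 1) i)
      have h5 := hεt t (by linarith [ht.1])
      have h6 : (1 - resetSignal t) * F t (z t) i + resetSignal t * V 0 i - V (n + 1) i =
        (1 - resetSignal t) * (F t (z t) i - V (n + 1) i) +
          resetSignal t * (V 0 i - V (n + 1) i) := by ring
      rw [h6]
      refine (abs_add_le _ _).trans ?_
      rw [abs_mul, abs_mul, abs_of_nonneg h3, abs_of_nonneg (by linarith [resetSignal_le_one t])]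
      have h7 : (1 - resetSignal t) * |F t (z t) i - V (n + 1) i| ≤
          1 * (K * (E + 14 * B * ε) + C * ε) := by
        refine mul_le_mul (by linarith) (h1.trans ?_) (abs_nonneg _) zero_le_one
        gcongr
      have h8 : resetSignal t * |V 0 i - V (n + 1) i| ≤ ε * (2 * B) :=
        mul_le_mul (h2.trans h5) h4 (abs_nonneg _) hε0.le
      linarith
    have := compute_cycle (j := j) (p := V (n + 1) i) (fun t ht => hy t (by linarith [ht.1]) i)
      (fun t ht => hyB t (by linarith [ht.1]) i) (fun t ht => hGB t (by linarith [ht.1]) i)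
      (hV (n + 1) i) hδ (t := t) ht
    have h9 : 14 * B * Real.exp (-j) ≤ 14 * B * ε := by
      have := hεt j le_rfl
      gcongr
    -- The new error `D * ε` never exceeds the accumulated one, so each step costs at most a factor
    -- `2K`.
    calc |y t i - V (n + 1) i| ≤ K * E + D * ε := by rw [hD]; linarith
      _ ≤ K * E + K * E := by nlinarith
      _ = _ := by rw [hE, pow_succ]; ring

lemma exists_pow_mul_exp_le {q X η : ℝ} (hq : 0 ≤ q) (hX : 0 ≤ X) (hη : 0 < η) :
    ∃ M₀ : ℕ, ∀ M ≥ M₀, q ^ M * X * Real.exp (-((M : ℝ) ^ 2 - 1)) ≤ η * Real.exp (-M) := by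
  obtain ⟨M₀, hM₀⟩ := exists_nat_ge (q + X / η + 2)
  refine ⟨M₀, fun M hM => ?_⟩
  have hM' : (M₀ : ℝ) ≤ M := by exact_mod_cast hM
  have hXη : 0 ≤ X / η := by positivity
  have h1 : q ^ M ≤ Real.exp (M * q) := by
    rw [Real.exp_nat_mul]
    exact pow_le_pow_left₀ hq (by linarith [Real.add_one_le_exp q]) M
  have h2 : X ≤ η * Real.exp (X / η) := by
    have : X / η ≤ Real.exp (X / η) := by linarith [Real.add_one_le_exp (X / η)]
    rwa [div_le_iff₀' hη] at this
  calc q ^ M * X * Real.exp (-((M : ℝ) ^ 2 - 1))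
      ≤ Real.exp (M * q) * (η * Real.exp (X / η)) * Real.exp (-((M : ℝ) ^ 2 - 1)) := by gcongr
    _ = η * Real.exp (M * q + X / η - ((M : ℝ) ^ 2 - 1)) := by
      rw [Real.exp_sub, Real.exp_add, Real.exp_neg]
      field_simp
    _ ≤ η * Real.exp (-M) := by
      gcongr
      nlinarith

/-- A robustly approximated discrete dynamical system is simulated, over and over again with
growing precision, by one generated function of time: while `M` is odd and `n ≤ M`, the value at
times close to `M ^ 2 + n` is close to the `n`-th iterate. -/
theorem exists_iteration {A κ : Type*} [Fintype κ] {B η K C : ℝ} (hB : 0 ≤ B) (hη : 0 < η)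
    (hK : 1 ≤ K) (hC : 0 ≤ C) {F : κ → A → (Option κ → ℝ) → ℝ}
    (hF : ∀ i, IsGen {v | 1 < v none} (F i))
    (hFB : ∀ i a, ∀ t > 1, ∀ x, |F i a (timeCons t x)| ≤ B)
    {V : A → ℕ → κ → ℝ} (hV : ∀ a n i, |V a n i| ≤ B)
    (hstep : ∀ a, ∀ t > 1, ∀ n x, ∀ e ≤ η, (∀ i, |x i - V a n i| ≤ e) →
      ∀ i, |F i a (timeCons t x) - V a (n + 1) i| ≤ K * e + C * Real.exp (-t)) :
    ∃ y : A → ℝ → κ → ℝ, (∀ i, IsGen {v : Unit → ℝ | 2 < v ()} fun a v => y a (v ()) i) ∧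
      (∀ a, ∀ t > 2, ∀ i, |y a t i| ≤ B) ∧
      ∃ M₀ : ℕ, ∀ a, ∀ M ≥ M₀, Odd M → ∀ n ≤ M, ∀ t : ℝ, |t - (M ^ 2 + n : ℕ)| ≤ 1 / 4 →
        ∀ i, |y a t i - V a n i| ≤ Real.exp (-M) := by
  have hc : ∀ {s : Option (κ ⊕ κ)}, IsGen (A := A) {v : Option (κ ⊕ κ) → ℝ | 1 < v none}
    fun _ v => v s := fun {s} => isGen_coord s
  have hn : ∀ {c : ℝ}, IsGen (A := A) {v : Option (κ ⊕ κ) → ℝ | 1 < v none}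
    fun _ _ => c := fun {c} => isGen_const c
  have hdrive : ∀ s, IsGen (A := A) {v : Option (κ ⊕ κ) → ℝ | 1 < v none}
      fun _ v => drive s (v none) := fun s =>
    (hn.mul hc).mul ((hn.mul hc).mul ((hn.mul (hn.mul hc).cos).sub hn)).sigmoid
  have hreset : IsGen (A := A) {v : Option (κ ⊕ κ) → ℝ | 1 < v none}
      fun _ v => resetSignal (v none) := by
    have hs : IsGen (A := A) {v : Option (κ ⊕ κ) → ℝ | 1 < v none} fun _ v => √(v none) :=
      hc.sqrt fun a v hv => le_of_lt hv
    exact (((hn.mul hs).mul (hn.mul hc)).mul (hn.mul hs).sin).sigmoid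
  -- The left summand is the computing variable `y`, the right one the memory `z`.
  let Φ : κ ⊕ κ → A → (Option (κ ⊕ κ) → ℝ) → ℝ := Sum.elim
    (fun i a v => drive (-1) (v none) *
      ((1 - resetSignal (v none)) * F i a (timeCons (v none) fun k => v (some (Sum.inr k))) +
        resetSignal (v none) * V a 0 i - v (some (Sum.inl i))))
    fun i a v => drive 1 (v none) * (v (some (Sum.inl i)) - v (some (Sum.inr i)))
  have hΦ : ∀ i, IsGen {v | 1 < v none} (Φ i) := by
    rintro (i | i)
    · refine (hdrive _).mul (((((isGen_const 1).sub hreset).mul ?_).add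
        (hreset.mul (isGen_param B fun a => hV a 0 i))).sub hc)
      refine (hF i).comp
        (h := fun o (_ : A) v => timeCons (v none) (fun k => v (some (Sum.inr k))) o)
        ?_ fun a v hv => hv
      rintro (_ | k)
      exacts [hc, hc]
    · exact (hdrive _).mul (hc.sub hc)
  -- Each component relaxes with nonnegative rate towards a target in `[-B, B]`, so the field points
  -- into the box.
  have hbd : ∀ a, ∀ t ≥ 2, ∀ Y : κ ⊕ κ → ℝ, ‖Y‖ ≤ B → ∀ i, ∃ g c, |g| ≤ B ∧ 0 ≤ c ∧
      Φ i a (timeCons t Y) = c * (g - Y i) := by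
    intro a t ht Y hY i
    rcases i with i | i
    · refine ⟨(1 - resetSignal t) * F i a (timeCons t fun k => Y (Sum.inr k)) +
        resetSignal t * V a 0 i, drive (-1) t, ?_, drive_nonneg (by linarith), rfl⟩
      have h1 := resetSignal_nonneg t
      have h2 := resetSignal_le_one t
      have h3 := abs_le.1 (hFB i a t (by linarith) fun k => Y (Sum.inr k))
      have h4 := abs_le.1 (hV a 0 i)
      exact abs_le.2 ⟨by nlinarith, by nlinarith⟩
    · exact ⟨Y (Sum.inl i), drive 1 t, (norm_le_pi_norm Y _).trans hY, drive_nonneg (by linarith),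
        rfl⟩
  obtain ⟨Y, hY, hYB, hYg⟩ := IsGen.exists_box_solution (t₀ := 2) (t₁ := 1) (by norm_num) hB hΦ
    (fun a t ht Y hY i hi => by
      obtain ⟨g, c, hg, hc, h⟩ := hbd a t ht Y hY i
      rw [h, hi]
      exact mul_nonpos_of_nonneg_of_nonpos hc (by linarith [(abs_le.1 hg).2]))
    (fun a t ht Y hY i hi => by
      obtain ⟨g, c, hg, hc, h⟩ := hbd a t ht Y hY i
      rw [h, hi]
      exact mul_nonneg hc (by linarith [(abs_le.1 hg).1]))
  have hYB' : ∀ a, ∀ t > 2, ∀ i, |Y a t i| ≤ B := fun a t ht i =>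
    (norm_le_pi_norm _ i).trans (hYB a t ht.le)
  refine ⟨fun a t i => Y a t (Sum.inl i), fun i => hYg _, fun a t ht i => hYB' a t ht _, ?_⟩
  -- With `min η 1` a single estimate gives both the admissible radius `η` and the final precision
  -- `exp (-M)`.
  obtain ⟨M₀, hM₀⟩ := exists_pow_mul_exp_le (q := 2 * K)
    (X := 2 * (14 * K * B + C + 16 * B)) (η := min η 1) (by linarith) (by positivity)
    (by positivity)
  refine ⟨M₀ + 2, fun a M hM hodd n hn t ht i => ?_⟩
  have hle := hM₀ M (by omega)
  have hexp : Real.exp (-(M : ℝ)) ≤ 1 := Real.exp_le_one_iff.2 (by simp)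
  have := iteration_bound (F := fun t x i => F i a (timeCons t x)) (V := V a) (η := η)
    (y := fun t i => Y a t (Sum.inl i)) (z := fun t i => Y a t (Sum.inr i)) hK hC
    (fun t ht i => hasDerivAt_pi.1 (hY a t ht) (Sum.inl i))
    (fun t ht i => hasDerivAt_pi.1 (hY a t ht) (Sum.inr i))
    (fun t ht i => hYB' a t ht _) (fun t ht i => hYB' a t ht _)
    (fun t ht i => hFB i a t (by linarith) _) (hV a)
    (fun t ht n x e he hx i => hstep a t (by linarith) n x e he hx i) hodd (by omega)
    (hle.trans ((mul_le_of_le_one_right (by positivity) hexp).trans (min_le_left _ _))) n hn t ht i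
  refine this.trans ?_
  have hpow : (2 * K) ^ n ≤ (2 * K) ^ M := pow_le_pow_right₀ (by linarith) hn
  have hD : 0 ≤ 14 * K * B + C + 16 * B := by positivity
  calc _ ≤ (2 * K) ^ M * (2 * (14 * K * B + C + 16 * B)) * Real.exp (-((M : ℝ) ^ 2 - 1)) := by
        gcongr
        linarith
    _ ≤ _ := hle
    _ ≤ 1 * Real.exp (-M) := by gcongr; exact min_le_right _ _
    _ = _ := one_mul _

/-! ## Smooth approximations of digits, indicators and truncation -/

/-- Smooth leading digit in base `r + 2`, for digits at most `r`. -/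
noncomputable def softDigit (r : ℕ) (ν x : ℝ) : ℝ :=
  ∑ l ∈ Finset.range r, Real.sigmoid (ν * ((r + 2) * x - (l + 1) + 1 / (2 * (r + 1))))

/-- Smooth indicator of the integer `i`. -/
noncomputable def softInd (ν : ℝ) (i : ℕ) (x : ℝ) : ℝ :=
  Real.sigmoid (ν * (x - i + 1 / 2)) * Real.sigmoid (ν * (i + 1 / 2 - x))

/-- Bounded function close to the identity on `[0, 1]`. -/
noncomputable def softClip (ν x : ℝ) : ℝ :=
  x * (Real.sigmoid (ν * (x + 1)) * Real.sigmoid (ν * (2 - x)))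

lemma softDigit_nonneg (r : ℕ) (ν x : ℝ) : 0 ≤ softDigit r ν x :=
  Finset.sum_nonneg fun _ _ => Real.sigmoid_nonneg _

lemma softDigit_le (r : ℕ) (ν x : ℝ) : softDigit r ν x ≤ r := by
  refine (Finset.sum_le_card_nsmul _ _ 1 fun _ _ => Real.sigmoid_le_one _).trans ?_
  simp

/-- The digit is the number of thresholds below `(r + 2) X = h + f`. Since `f ≤ 1 - 1 / (r + 1)`,
thresholds placed `1 / (2 (r + 1))` below the integers have that margin on both sides. The error in
`x` uses up half of it, and the factor `4 (r + 1)` turns the rest into `t`. -/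
lemma softDigit_close {r h : ℕ} {t x X f : ℝ} (ht : 0 ≤ t) (hh : h ≤ r) (hf0 : 0 ≤ f)
    (hf : f ≤ r / (r + 1)) (hX : (r + 2) * X = h + f)
    (hx : |x - X| ≤ 1 / (4 * (r + 1) * (r + 2))) :
    |softDigit r (4 * (r + 1) * t) x - h| ≤ r * Real.exp (-t) := by
  have hsum : (h : ℝ) = ∑ l ∈ Finset.range r, if l + 1 ≤ h then (1 : ℝ) else 0 := by
    rw [Finset.sum_ite, Finset.sum_const_zero, add_zero, Finset.sum_const, nsmul_one]
    congr 1
    have : (Finset.range r).filter (fun l => l + 1 ≤ h) = Finset.range h := by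
      ext l
      simp only [Finset.mem_filter, Finset.mem_range]
      omega
    rw [this, Finset.card_range]
  have hr : (0 : ℝ) < r + 1 := by positivity
  have hd : |(r + 2) * x - (h + f)| ≤ 1 / (4 * (r + 1)) := by
    rw [← hX, ← mul_sub, abs_mul, abs_of_pos (by positivity)]
    calc (r + 2 : ℝ) * |x - X| ≤ (r + 2) * (1 / (4 * (r + 1) * (r + 2))) := by gcongr
      _ = _ := by field_simp
  have hd' := abs_le.1 hd
  have hf' : f ≤ 1 - 1 / (r + 1) := hf.trans_eq (by field_simp; ring)
  have hm2 : (1 : ℝ) / (2 * (r + 1)) = 2 * (1 / (4 * (r + 1))) := by field_simp; norm_num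
  have hm4 : (1 : ℝ) / (r + 1) = 4 * (1 / (4 * (r + 1))) := by field_simp
  have hmt : 4 * (r + 1) * t * (1 / (4 * (r + 1))) = t := by field_simp
  have hν : 0 ≤ 4 * (r + 1) * t := by positivity
  rw [hm4] at hf'
  rw [hsum, softDigit, ← Finset.sum_sub_distrib]
  refine (Finset.abs_sum_le_sum_abs _ _).trans ?_
  refine (Finset.sum_le_card_nsmul _ _ (Real.exp (-t)) fun l _ => ?_).trans_eq (by simp)
  rw [hm2]
  split_ifs with hl
  · rw [abs_sub_comm, abs_of_nonneg (sub_nonneg.2 (Real.sigmoid_le_one _))]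
    refine one_sub_sigmoid_le_exp_of_le (neg_le_neg ?_)
    have hl' : (l : ℝ) + 1 ≤ h := by exact_mod_cast hl
    calc t = 4 * (r + 1) * t * (1 / (4 * (r + 1))) := hmt.symm
      _ ≤ _ := mul_le_mul_of_nonneg_left (by linarith) hν
  · rw [sub_zero, abs_of_nonneg (Real.sigmoid_nonneg _)]
    refine sigmoid_le_exp_of_le ?_
    have hl' : (h : ℝ) ≤ l := by exact_mod_cast (by omega : h ≤ l)
    calc _ ≤ 4 * (r + 1) * t * (-(1 / (4 * (r + 1)))) :=
          mul_le_mul_of_nonneg_left (by linarith) hν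
      _ = -t := by rw [mul_neg, hmt]

lemma softInd_nonneg (ν : ℝ) (i : ℕ) (x : ℝ) : 0 ≤ softInd ν i x :=
  mul_nonneg (Real.sigmoid_nonneg _) (Real.sigmoid_nonneg _)

lemma softInd_le_one (ν : ℝ) (i : ℕ) (x : ℝ) : softInd ν i x ≤ 1 :=
  mul_le_one₀ (Real.sigmoid_le_one _) (Real.sigmoid_nonneg _) (Real.sigmoid_le_one _)

lemma one_sub_mul_le {a b ε : ℝ} (ha1 : a ≤ 1) (ha : 1 - a ≤ ε)
    (hb' : 1 - b ≤ ε) (hb1 : b ≤ 1) : 1 - a * b ≤ 2 * ε := by nlinarith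

lemma softInd_self_close {ν t x : ℝ} {i : ℕ} (hν : 4 * t ≤ ν) (ht : 0 ≤ t) (hx : |x - i| ≤ 1 / 8) :
    1 - softInd ν i x ≤ 2 * Real.exp (-t) := by
  obtain ⟨h1, h2⟩ := abs_le.1 hx
  exact one_sub_mul_le (Real.sigmoid_le_one _)
    (one_sub_sigmoid_le_exp_of_le (by nlinarith)) (one_sub_sigmoid_le_exp_of_le (by nlinarith))
    (Real.sigmoid_le_one _)

lemma softInd_ne_close {ν t x : ℝ} {i j : ℕ} (hν : 4 * t ≤ ν) (ht : 0 ≤ t) (hx : |x - j| ≤ 1 / 8)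
    (hij : i ≠ j) : softInd ν i x ≤ Real.exp (-t) := by
  obtain ⟨h1, h2⟩ := abs_le.1 hx
  rcases lt_or_gt_of_ne hij with h | h
  · have h' : (i : ℝ) + 1 ≤ j := by exact_mod_cast h
    have h3 : Real.sigmoid (ν * (i + 1 / 2 - x)) ≤ Real.exp (-t) :=
      sigmoid_le_exp_of_le (by nlinarith)
    exact (mul_le_of_le_one_left (Real.sigmoid_nonneg _) (Real.sigmoid_le_one _)).trans h3
  · have h' : (j : ℝ) + 1 ≤ i := by exact_mod_cast h
    have h3 : Real.sigmoid (ν * (x - i + 1 / 2)) ≤ Real.exp (-t) :=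
      sigmoid_le_exp_of_le (by nlinarith)
    exact (mul_le_of_le_one_right (Real.sigmoid_nonneg _) (Real.sigmoid_le_one _)).trans h3

/-- For `|x| ≥ 2` one sigmoid factor is at most `exp (2 - |x|)`, which beats the growth of `x`. A
bound for all `x` is needed because the iterated map must take values in the box everywhere. -/
lemma abs_softClip_le {ν x : ℝ} (hν : 1 ≤ ν) : |softClip ν x| ≤ 2 := by
  have h1 := Real.sigmoid_nonneg (ν * (x + 1))
  have h2 := Real.sigmoid_nonneg (ν * (2 - x))
  have h3 := Real.sigmoid_le_one (ν * (x + 1))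
  have h4 := Real.sigmoid_le_one (ν * (2 - x))
  rw [softClip, abs_mul, abs_of_nonneg (mul_nonneg h1 h2)]
  rcases le_total |x| 2 with h | h
  · exact (mul_le_of_le_one_right (abs_nonneg _) (mul_le_one₀ h3 h2 h4)).trans h
  have he : |x| * Real.exp (2 - |x|) ≤ 2 := by
    have h5 := Real.add_one_le_exp (|x| - 2)
    have h6 : Real.exp (2 - |x|) * Real.exp (|x| - 2) = 1 := by
      rw [← Real.exp_add]; simp
    have h7 := Real.exp_pos (2 - |x|)
    nlinarith
  refine le_trans (mul_le_mul_of_nonneg_left ?_ (abs_nonneg _)) he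
  rcases le_total 0 x with hx | hx
  · rw [abs_of_nonneg hx] at h ⊢
    exact (mul_le_of_le_one_left h2 h3).trans (sigmoid_le_exp_of_le (by nlinarith))
  · rw [abs_of_nonpos hx] at h ⊢
    exact (mul_le_of_le_one_right h1 h4).trans (sigmoid_le_exp_of_le (by nlinarith))

lemma softClip_close {ν t x X e : ℝ} (hν : 4 * t ≤ ν) (ht : 0 ≤ t) (hX0 : 0 ≤ X) (hX1 : X ≤ 1)
    (hx : |x - X| ≤ e) (he : e ≤ 1 / 8) : |softClip ν x - X| ≤ e + 4 * Real.exp (-t) := by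
  obtain ⟨h1, h2⟩ := abs_le.1 hx
  have h3 : 1 - Real.sigmoid (ν * (x + 1)) * Real.sigmoid (ν * (2 - x)) ≤ 2 * Real.exp (-t) :=
    one_sub_mul_le (Real.sigmoid_le_one _)
      (one_sub_sigmoid_le_exp_of_le (by nlinarith)) (one_sub_sigmoid_le_exp_of_le (by nlinarith))
      (Real.sigmoid_le_one _)
  have h4 : Real.sigmoid (ν * (x + 1)) * Real.sigmoid (ν * (2 - x)) ≤ 1 :=
    mul_le_one₀ (Real.sigmoid_le_one _) (Real.sigmoid_nonneg _) (Real.sigmoid_le_one _)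
  have h5 : softClip ν x - X = (x - X) -
      x * (1 - Real.sigmoid (ν * (x + 1)) * Real.sigmoid (ν * (2 - x))) := by
    rw [softClip]; ring
  have h6 : |x| ≤ 2 := abs_le.2 ⟨by linarith, by linarith⟩
  rw [h5]
  refine (abs_sub _ _).trans (add_le_add hx ?_)
  rw [abs_mul, abs_of_nonneg (by linarith : 0 ≤ 1 - Real.sigmoid (ν * (x + 1)) *
    Real.sigmoid (ν * (2 - x)))]
  calc _ ≤ 2 * (2 * Real.exp (-t)) := mul_le_mul h6 h3 (by linarith) (by norm_num)
    _ = _ := by ring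

/-! ## The encoding of half-tapes -/

namespace Machine

variable (M : Machine)

lemma frac_summable (l : Turing.ListBlank (Fin (M.r + 1))) :
    Summable fun i : ℕ => ((l.nth i : ℕ) : ℝ) / (M.k : ℝ) ^ (i + 1) := by
  have hk : (1 : ℝ) < M.k := by
    rw [k]; push_cast; linarith [(Nat.cast_nonneg M.r : (0 : ℝ) ≤ M.r)]
  refine Summable.of_nonneg_of_le (fun i => by positivity) (fun i => ?_)
    ((summable_geometric_of_lt_one (by positivity) (inv_lt_one_of_one_lt₀ hk)).mul_left (M.r : ℝ))
  have h1 : ((l.nth i : ℕ) : ℝ) ≤ M.r := by exact_mod_cast Nat.lt_succ_iff.1 (l.nth i).2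
  rw [div_eq_mul_inv, inv_pow]
  gcongr
  exacts [hk.le, by omega]

lemma frac_nonneg (l : Turing.ListBlank (Fin (M.r + 1))) : 0 ≤ M.frac l :=
  tsum_nonneg fun i => by positivity

lemma k_mul_frac (l : Turing.ListBlank (Fin (M.r + 1))) :
    (M.r + 2 : ℝ) * M.frac l = (l.head : ℕ) + M.frac l.tail := by
  have hk : (M.k : ℝ) = M.r + 2 := by simp [k]
  have hk0 : (M.r + 2 : ℝ) ≠ 0 := by positivity
  rw [frac, (M.frac_summable l).tsum_eq_zero_add, mul_add, frac, ← tsum_mul_left]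
  congr 1
  · rw [hk, zero_add, pow_one, Turing.ListBlank.nth_zero]
    field_simp
  · refine tsum_congr fun i => ?_
    rw [hk, Turing.ListBlank.nth_succ]
    field_simp
    ring

lemma frac_cons (a : Fin (M.r + 1)) (l : Turing.ListBlank (Fin (M.r + 1))) :
    M.frac (l.cons a) = (M.frac l + (a : ℕ)) / (M.r + 2) := by
  have := M.k_mul_frac (l.cons a)
  rw [Turing.ListBlank.head_cons, Turing.ListBlank.tail_cons] at this
  rw [eq_div_iff (by positivity)]
  linarith

/-- Digits are at most `k - 2`, so the geometric series stops short of `1` by `1 / (r + 1)`; this is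
the gap that makes digit extraction robust. -/
lemma frac_le (l : Turing.ListBlank (Fin (M.r + 1))) : M.frac l ≤ M.r / (M.r + 1) := by
  have hk : (M.k : ℝ) = M.r + 2 := by simp [k]
  have hk1 : (M.r + 2 : ℝ)⁻¹ < 1 :=
    inv_lt_one_of_one_lt₀ (by linarith [(Nat.cast_nonneg M.r : (0 : ℝ) ≤ M.r)])
  have hg := (summable_geometric_of_lt_one (by positivity) hk1).mul_left (M.r / (M.r + 2) : ℝ)
  calc M.frac l ≤ ∑' i : ℕ, (M.r / (M.r + 2) : ℝ) * (M.r + 2 : ℝ)⁻¹ ^ i := by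
        refine (M.frac_summable l).tsum_le_tsum (fun i => ?_) hg
        have h1 : ((l.nth i : ℕ) : ℝ) ≤ M.r := by exact_mod_cast Nat.lt_succ_iff.1 (l.nth i).2
        rw [hk, pow_succ', ← div_div, inv_pow, ← div_eq_mul_inv]
        gcongr
    _ = _ := by
      rw [tsum_mul_left, tsum_geometric_of_lt_one (by positivity) hk1]
      have : (1 : ℝ) - (M.r + 2 : ℝ)⁻¹ = (M.r + 1) / (M.r + 2) := by field_simp; ring
      rw [this]
      field_simp

lemma frac_le_one (l : Turing.ListBlank (Fin (M.r + 1))) : M.frac l ≤ 1 :=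
  (M.frac_le l).trans (div_le_one_of_le₀ (by linarith) (by positivity))

/-! ## A generated approximation of the transition map -/

/-- The action of one transition on encoded configurations. -/
noncomputable def branch (p : Fin M.m × Fin (M.r + 1)) (ν : ℝ) (x : Fin 4 → ℝ) : Fin 4 → ℝ :=
  match (M.δ p).2.2 with
  | .right => ![(softClip ν (x 0) + ((M.δ p).2.1 : ℕ)) * (M.r + 2 : ℝ)⁻¹, softDigit M.r ν (x 2),
      (M.r + 2) * softClip ν (x 2) - softDigit M.r ν (x 2), ((M.δ p).1 : ℕ)]
  | .left => ![(M.r + 2) * softClip ν (x 0) - softDigit M.r ν (x 0), softDigit M.r ν (x 0),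
      (softClip ν (x 2) + ((M.δ p).2.1 : ℕ)) * (M.r + 2 : ℝ)⁻¹, ((M.δ p).1 : ℕ)]

variable {M} in
lemma branch_of_right {p : Fin M.m × Fin (M.r + 1)} (h : (M.δ p).2.2 = .right) (ν : ℝ)
    (x : Fin 4 → ℝ) : M.branch p ν x =
      ![(softClip ν (x 0) + ((M.δ p).2.1 : ℕ)) * (M.r + 2 : ℝ)⁻¹, softDigit M.r ν (x 2),
        (M.r + 2) * softClip ν (x 2) - softDigit M.r ν (x 2), ((M.δ p).1 : ℕ)] := by
  simp only [branch, h]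

variable {M} in
lemma branch_of_left {p : Fin M.m × Fin (M.r + 1)} (h : (M.δ p).2.2 = .left) (ν : ℝ)
    (x : Fin 4 → ℝ) : M.branch p ν x =
      ![(M.r + 2) * softClip ν (x 0) - softDigit M.r ν (x 0), softDigit M.r ν (x 0),
        (softClip ν (x 2) + ((M.δ p).2.1 : ℕ)) * (M.r + 2 : ℝ)⁻¹, ((M.δ p).1 : ℕ)] := by
  simp only [branch, h]

/-- The smooth transition map at time `t`, on encoded configurations. -/
noncomputable def softStep (i : Fin 4) (v : Option (Fin 4) → ℝ) : ℝ :=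
  ∑ p : Fin M.m × Fin (M.r + 1), softInd (4 * (M.r + 1) * v none) p.1 (v (some 3)) *
    softInd (4 * (M.r + 1) * v none) p.2 (v (some 1)) *
    M.branch p (4 * (M.r + 1) * v none) (fun j => v (some j)) i

section Gen

variable {A ι : Type*} [Fintype ι] {U : Set (ι → ℝ)}

lemma isGen_softDigit (r : ℕ) {ν x : A → (ι → ℝ) → ℝ} (hν : IsGen U ν) (hx : IsGen U x) :
    IsGen U fun a v => softDigit r (ν a v) (x a v) :=
  IsGen.sum _ fun _ _ => (hν.mul ((((isGen_const _).mul hx).sub (isGen_const _)).add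
    (isGen_const _))).sigmoid

lemma isGen_softInd (i : ℕ) {ν x : A → (ι → ℝ) → ℝ} (hν : IsGen U ν) (hx : IsGen U x) :
    IsGen U fun a v => softInd (ν a v) i (x a v) :=
  (hν.mul ((hx.sub (isGen_const _)).add (isGen_const _))).sigmoid.mul
    (hν.mul ((isGen_const _).sub hx)).sigmoid

lemma isGen_softClip {ν x : A → (ι → ℝ) → ℝ} (hν : IsGen U ν) (hx : IsGen U x) :
    IsGen U fun a v => softClip (ν a v) (x a v) :=
  hx.mul ((hν.mul (hx.add (isGen_const _))).sigmoid.mul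
    (hν.mul ((isGen_const _).sub hx)).sigmoid)

lemma isGen_softStep (i : Fin 4) {U : Set (Option (Fin 4) → ℝ)} :
    IsGen U fun (_ : A) v => M.softStep i v := by
  have hν : IsGen (A := A) U fun _ v => 4 * (M.r + 1) * v none :=
    (isGen_const _).mul (isGen_coord none)
  refine IsGen.sum _ fun p _ => ((isGen_softInd _ hν (isGen_coord _)).mul
    (isGen_softInd _ hν (isGen_coord _))).mul ?_
  have hc : ∀ j, IsGen (A := A) U fun _ v => softClip (4 * (M.r + 1) * v none) (v (some j)) :=
    fun j => isGen_softClip hν (isGen_coord _)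
  have hd : ∀ j, IsGen (A := A) U fun _ v =>
      softDigit M.r (4 * (M.r + 1) * v none) (v (some j)) :=
    fun j => isGen_softDigit _ hν (isGen_coord _)
  rcases hdir : (M.δ p).2.2 with _ | _
  · simp only [branch_of_left hdir]
    fin_cases i
    exacts [((isGen_const _).mul (hc 0)).sub (hd 0), hd 0,
      ((hc 2).add (isGen_const _)).mul (isGen_const _), isGen_const _]
  · simp only [branch_of_right hdir]
    fin_cases i
    exacts [((hc 0).add (isGen_const _)).mul (isGen_const _), hd 2,
      ((isGen_const _).mul (hc 2)).sub (hd 2), isGen_const _]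

end Gen

/-- A bound for all branches of the transition map. -/
noncomputable def branchBound : ℝ := 3 * (M.r + 2) + M.m

lemma branchBound_nonneg : 0 ≤ M.branchBound := by unfold branchBound; positivity

lemma abs_branch_le (p : Fin M.m × Fin (M.r + 1)) {ν : ℝ} (hν : 1 ≤ ν) (x : Fin 4 → ℝ)
    (i : Fin 4) : |M.branch p ν x i| ≤ M.branchBound := by
  have hr : (0 : ℝ) ≤ M.r := Nat.cast_nonneg _
  have hm : (0 : ℝ) ≤ M.m := Nat.cast_nonneg _
  have hs : (((M.δ p).2.1 : ℕ) : ℝ) ≤ M.r := by exact_mod_cast Nat.lt_succ_iff.1 (M.δ p).2.1.2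
  have hq : |(((M.δ p).1 : ℕ) : ℝ)| ≤ M.branchBound := by
    have : (((M.δ p).1 : ℕ) : ℝ) ≤ M.m := by exact_mod_cast (M.δ p).1.2.le
    rw [Nat.abs_cast, branchBound]
    linarith
  have hd : ∀ j, |softDigit M.r ν (x j)| ≤ M.branchBound := fun j => by
    rw [abs_of_nonneg (softDigit_nonneg _ _ _), branchBound]
    linarith [softDigit_le M.r ν (x j)]
  have hpush : ∀ j, |(softClip ν (x j) + ((M.δ p).2.1 : ℕ)) * (M.r + 2 : ℝ)⁻¹| ≤
      M.branchBound := fun j => by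
    have hi : (M.r + 2 : ℝ)⁻¹ ≤ 1 := inv_le_one_of_one_le₀ (by linarith)
    rw [abs_mul, abs_of_nonneg (by positivity : (0 : ℝ) ≤ (M.r + 2 : ℝ)⁻¹)]
    refine (mul_le_of_le_one_right (abs_nonneg _) hi).trans ((abs_add_le _ _).trans ?_)
    rw [Nat.abs_cast, branchBound]
    linarith [abs_softClip_le (x := x j) hν]
  have hpop : ∀ j, |(M.r + 2) * softClip ν (x j) - softDigit M.r ν (x j)| ≤ M.branchBound := by
    intro j
    have h1 := abs_le.1 (abs_softClip_le (x := x j) hν)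
    have h2 := softDigit_nonneg M.r ν (x j)
    have h3 := softDigit_le M.r ν (x j)
    rw [branchBound]
    exact abs_le.2 ⟨by nlinarith, by nlinarith⟩
  rcases hdir : (M.δ p).2.2 with _ | _
  · rw [branch_of_left hdir]
    fin_cases i
    exacts [hpop 0, hd 0, hpush 2, hq]
  · rw [branch_of_right hdir]
    fin_cases i
    exacts [hpush 0, hd 2, hpop 2, hq]

/-- A bound for the transition map and for all encodings. -/
noncomputable def stepBound : ℝ := (M.m * (M.r + 1) + 1) * M.branchBound

lemma stepBound_nonneg : 0 ≤ M.stepBound := by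
  have := M.branchBound_nonneg
  unfold stepBound; positivity

lemma abs_softStep_le (i : Fin 4) {t : ℝ} (ht : 1 < t) (x : Fin 4 → ℝ) :
    |M.softStep i (timeCons t x)| ≤ M.stepBound := by
  have hr : (0 : ℝ) ≤ M.r := Nat.cast_nonneg _
  have hν : 1 ≤ 4 * (M.r + 1) * t := by nlinarith
  have hb := M.branchBound_nonneg
  refine (Finset.abs_sum_le_sum_abs _ _).trans
    ((Finset.sum_le_card_nsmul _ _ M.branchBound fun p _ => ?_).trans ?_)
  · rw [abs_mul, abs_of_nonneg (mul_nonneg (softInd_nonneg _ _ _) (softInd_nonneg _ _ _))]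
    exact (mul_le_of_le_one_left (abs_nonneg _) (mul_le_one₀ (softInd_le_one _ _ _)
      (softInd_nonneg _ _ _) (softInd_le_one _ _ _))).trans (M.abs_branch_le p hν _ i)
  · simp [stepBound]
    linarith

lemma abs_encode_le (c : M.Config) (i : Fin 4) : |M.encode c i| ≤ M.stepBound := by
  have hr : (0 : ℝ) ≤ M.r := Nat.cast_nonneg _
  have hm : (0 : ℝ) ≤ M.m := Nat.cast_nonneg _
  have h : |M.encode c i| ≤ M.branchBound := by
    have h1 : ∀ l, |M.frac l| ≤ M.branchBound := fun l => by
      rw [abs_of_nonneg (M.frac_nonneg l), branchBound]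
      linarith [M.frac_le_one l]
    have h2 : |((c.tape.head : ℕ) : ℝ)| ≤ M.branchBound := by
      have : ((c.tape.head : ℕ) : ℝ) ≤ M.r := by exact_mod_cast Nat.lt_succ_iff.1 c.tape.head.2
      rw [Nat.abs_cast, branchBound]
      linarith
    have h3 : |((c.state : ℕ) : ℝ)| ≤ M.branchBound := by
      have : ((c.state : ℕ) : ℝ) ≤ M.m := by exact_mod_cast c.state.2.le
      rw [Nat.abs_cast, branchBound]
      linarith
    fin_cases i
    exacts [h1 _, h2, h1 _, h3]
  have hb := M.branchBound_nonneg
  refine h.trans (le_mul_of_one_le_left hb ?_)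
  nlinarith

/-- Pushing a symbol contracts errors; popping one multiplies them by the base `r + 2`, which is the
expansion constant of the simulation. -/
lemma branch_close (c : M.Config) {t e : ℝ} (ht : 0 ≤ t) {x : Fin 4 → ℝ}
    (he : e ≤ 1 / (4 * (M.r + 1) * (M.r + 2))) (hx : ∀ i, |x i - M.encode c i| ≤ e) (i : Fin 4) :
    |M.branch (c.state, c.tape.head) (4 * (M.r + 1) * t) x i - M.encode (M.step c) i| ≤
      (M.r + 2) * e + (4 * (M.r + 2) + M.r) * Real.exp (-t) := by
  have hr : (0 : ℝ) ≤ M.r := Nat.cast_nonneg _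
  have hE := Real.exp_pos (-t)
  have he0 : 0 ≤ e := (abs_nonneg _).trans (hx 0)
  have he8 : e ≤ 1 / 8 := he.trans (one_div_le_one_div_of_le (by norm_num) (by nlinarith))
  have hν : 4 * t ≤ 4 * (M.r + 1) * t := by nlinarith
  have hclip : ∀ (l : Turing.ListBlank (Fin (M.r + 1))) (u : ℝ), |u - M.frac l| ≤ e →
      |softClip (4 * (M.r + 1) * t) u - M.frac l| ≤ e + 4 * Real.exp (-t) := fun l u hu =>
    softClip_close hν ht (M.frac_nonneg l) (M.frac_le_one l) hu he8
  have hdig : ∀ (l : Turing.ListBlank (Fin (M.r + 1))) (u : ℝ), |u - M.frac l| ≤ e →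
      |softDigit M.r (4 * (M.r + 1) * t) u - (l.head : ℕ)| ≤ M.r * Real.exp (-t) := fun l u hu =>
    softDigit_close ht (Nat.lt_succ_iff.1 l.head.2) (M.frac_nonneg _) (M.frac_le _)
      (M.k_mul_frac l) (hu.trans he)
  have hdig' : ∀ (l : Turing.ListBlank (Fin (M.r + 1))) (u : ℝ), |u - M.frac l| ≤ e →
      |softDigit M.r (4 * (M.r + 1) * t) u - (l.head : ℕ)| ≤
        (M.r + 2) * e + (4 * (M.r + 2) + M.r) * Real.exp (-t) := fun l u hu =>
    (hdig l u hu).trans (by nlinarith)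
  have hpush : ∀ (l : Turing.ListBlank (Fin (M.r + 1))) (u : ℝ) (a : Fin (M.r + 1)),
      |u - M.frac l| ≤ e →
      |(softClip (4 * (M.r + 1) * t) u + (a : ℕ)) * (M.r + 2 : ℝ)⁻¹ - M.frac (l.cons a)| ≤
        (M.r + 2) * e + (4 * (M.r + 2) + M.r) * Real.exp (-t) := fun l u a hu => by
    rw [frac_cons, div_eq_mul_inv, ← sub_mul, add_sub_add_right_eq_sub, abs_mul,
      abs_of_nonneg (by positivity : (0 : ℝ) ≤ (M.r + 2 : ℝ)⁻¹)]
    have hi : (M.r + 2 : ℝ)⁻¹ ≤ 1 := inv_le_one_of_one_le₀ (by linarith)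
    exact ((mul_le_of_le_one_right (abs_nonneg _) hi).trans (hclip l u hu)).trans (by nlinarith)
  have hpop : ∀ (l : Turing.ListBlank (Fin (M.r + 1))) (u : ℝ), |u - M.frac l| ≤ e →
      |(M.r + 2) * softClip (4 * (M.r + 1) * t) u - softDigit M.r (4 * (M.r + 1) * t) u -
        M.frac l.tail| ≤
        (M.r + 2) * e + (4 * (M.r + 2) + M.r) * Real.exp (-t) := fun l u hu => by
    have h1 := M.k_mul_frac l
    have h2 := abs_le.1 (hclip l u hu)
    have h3 := abs_le.1 (hdig l u hu)
    exact abs_le.2 ⟨by nlinarith, by nlinarith⟩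
  have hz : |((((M.δ (c.state, c.tape.head)).1 : ℕ) : ℝ)) -
      (((M.δ (c.state, c.tape.head)).1 : ℕ))| ≤
      (M.r + 2) * e + (4 * (M.r + 2) + M.r) * Real.exp (-t) := by
    rw [sub_self, abs_zero]
    positivity
  obtain ⟨⟨s, L, R⟩, q⟩ := c
  have h0 : |x 0 - M.frac L| ≤ e := hx 0
  have h2 : |x 2 - M.frac R| ≤ e := hx 2
  rcases hdir : (M.δ (q, s)).2.2 with _ | _
  · have hstep : M.encode (M.step ⟨⟨s, L, R⟩, q⟩) =
        ![M.frac L.tail, (L.head : ℕ), M.frac (R.cons (M.δ (q, s)).2.1), ((M.δ (q, s)).1 : ℕ)] := by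
      simp only [step, hdir]
      rfl
    rw [hstep, branch_of_left hdir]
    fin_cases i
    exacts [hpop L _ h0, hdig' L _ h0, hpush R _ _ h2, hz]
  · have hstep : M.encode (M.step ⟨⟨s, L, R⟩, q⟩) =
        ![M.frac (L.cons (M.δ (q, s)).2.1), (R.head : ℕ), M.frac R.tail, ((M.δ (q, s)).1 : ℕ)] := by
      simp only [step, hdir]
      rfl
    rw [hstep, branch_of_right hdir]
    fin_cases i
    exacts [hpush L _ _ h0, hdig' R _ h2, hpop R _ h2, hz]

/-- The soft indicators select the branch of the true state and symbol up to `4 exp (-t)` per pair,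
and all branches are bounded. -/
lemma softStep_close (c : M.Config) {t e : ℝ} (ht : 1 < t) {x : Fin 4 → ℝ}
    (he : e ≤ 1 / (4 * (M.r + 1) * (M.r + 2))) (hx : ∀ i, |x i - M.encode c i| ≤ e) (i : Fin 4) :
    |M.softStep i (timeCons t x) - M.encode (M.step c) i| ≤ (M.r + 2) * e +
      (4 * (M.r + 2) + M.r + 4 * M.stepBound) * Real.exp (-t) := by
  have hr : (0 : ℝ) ≤ M.r := Nat.cast_nonneg _
  have hE := Real.exp_pos (-t)
  have he8 : e ≤ 1 / 8 := he.trans (one_div_le_one_div_of_le (by norm_num) (by nlinarith))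
  have hν : 4 * t ≤ 4 * (M.r + 1) * t := by nlinarith
  have hB0 := M.branchBound_nonneg
  set ν := 4 * (M.r + 1) * t with hνdef
  have hs : |x 1 - (c.tape.head : ℕ)| ≤ 1 / 8 := (hx 1).trans he8
  have hq : |x 3 - (c.state : ℕ)| ≤ 1 / 8 := (hx 3).trans he8
  have hw : ∀ p : Fin M.m × Fin (M.r + 1), |softInd ν p.1 (x 3) * softInd ν p.2 (x 1) -
      if p = (c.state, c.tape.head) then 1 else 0| ≤ 4 * Real.exp (-t) := by
    intro p
    have h1 := softInd_nonneg ν p.1 (x 3)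
    have h2 := softInd_nonneg ν p.2 (x 1)
    have h3 := softInd_le_one ν p.1 (x 3)
    have h4 := softInd_le_one ν p.2 (x 1)
    split_ifs with hp
    · rw [abs_sub_comm, abs_of_nonneg (sub_nonneg.2 (mul_le_one₀ h3 h2 h4))]
      subst hp
      have := one_sub_mul_le h3 (softInd_self_close hν (by linarith) hq)
        (softInd_self_close hν (by linarith) hs) h4
      linarith
    · rw [sub_zero, abs_of_nonneg (mul_nonneg h1 h2)]
      by_cases hp1 : p.1 = c.state
      · have hp2 : (p.2 : ℕ) ≠ c.tape.head := fun h => hp (Prod.ext hp1 (Fin.ext h))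
        have h5 := softInd_ne_close hν (by linarith) hs hp2
        nlinarith
      · have h5 := softInd_ne_close hν (by linarith) hq fun h => hp1 (Fin.ext h)
        nlinarith
  have hdiff : |M.softStep i (timeCons t x) - M.branch (c.state, c.tape.head) ν x i| ≤
      4 * M.stepBound * Real.exp (-t) := by
    have h1 : M.branch (c.state, c.tape.head) ν x i = ∑ p : Fin M.m × Fin (M.r + 1),
        (if p = (c.state, c.tape.head) then 1 else 0) * M.branch p ν x i := by simp
    have h2 : M.softStep i (timeCons t x) = ∑ p : Fin M.m × Fin (M.r + 1),
        softInd ν p.1 (x 3) * softInd ν p.2 (x 1) * M.branch p ν x i := rfl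
    rw [h1, h2, ← Finset.sum_sub_distrib]
    refine (Finset.abs_sum_le_sum_abs _ _).trans ((Finset.sum_le_card_nsmul _ _
      (4 * Real.exp (-t) * M.branchBound) fun p _ => ?_).trans ?_)
    · rw [← sub_mul, abs_mul]
      exact mul_le_mul (hw p) (M.abs_branch_le p (by nlinarith) x i) (abs_nonneg _) (by positivity)
    · simp only [Finset.card_univ, Fintype.card_prod, Fintype.card_fin, nsmul_eq_mul, stepBound]
      push_cast
      nlinarith [mul_nonneg hE.le hB0]
  have hb := M.branch_close c (by linarith : 0 ≤ t) he hx i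
  have := abs_sub_le (M.softStep i (timeCons t x)) (M.branch (c.state, c.tape.head) ν x i)
    (M.encode (M.step c) i)
  linarith

end Machine

/-! ## Reading off the simulation -/

lemma abs_arctan_sub_le (x y : ℝ) : |Real.arctan x - Real.arctan y| ≤ |x - y| := by
  have h := convex_univ.norm_image_sub_le_of_norm_hasDerivWithin_le (C := 1) (f := Real.arctan)
    (fun t _ => (Real.hasDerivAt_arctan t).hasDerivWithinAt) (fun t _ => by
      rw [Real.norm_eq_abs, abs_of_nonneg (by positivity), div_le_one (by positivity)]
      nlinarith [sq_nonneg t]) (Set.mem_univ y) (Set.mem_univ x)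
  simpa using h

/-- Smooth rounding to the nearest integer, accurate away from half-integers. -/
noncomputable def softRound (a : ℝ) : ℝ :=
  a - Real.pi⁻¹ * Real.arctan (Real.sin (Real.pi * a) * Real.cos (Real.pi * a) * (256 * (a + 1)) *
    (1 + Real.cos (Real.pi * a) ^ 2 * (256 * (a + 1)))⁻¹)

lemma abs_softRound_sub_self_le (a : ℝ) : |softRound a - a| ≤ 1 / 2 := by
  have hp := Real.pi_pos
  rw [softRound, sub_sub_cancel_left, abs_neg, abs_mul, abs_of_pos (by positivity)]
  have : ∀ x, |Real.arctan x| ≤ Real.pi / 2 := fun x =>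
    abs_le.2 ⟨(Real.neg_pi_div_two_lt_arctan x).le, (Real.arctan_lt_pi_div_two x).le⟩
  calc _ ≤ Real.pi⁻¹ * (Real.pi / 2) := by gcongr; exact this _
    _ = 1 / 2 := by field_simp

/-- Exact rounding is `a - arctan (tan (π a)) / π`. With `s`, `c` the sine and cosine, `softRound`
replaces `s / c` by the pole-free `s c w / (1 + c² w)`; the difference `s / (c (1 + c² w))` is at
most `8 / w` when `|c| ≥ 1/2`. -/
lemma abs_softRound_sub_le {a : ℝ} (ha : 0 ≤ a) {m : ℤ} (hm : |a - m| ≤ 1 / 2)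
    (hc : 1 / 4 ≤ Real.cos (Real.pi * a) ^ 2) : |softRound a - m| ≤ 8 / (256 * (a + 1)) := by
  have hp := Real.pi_pos
  have hp1 : Real.pi⁻¹ ≤ 1 := inv_le_one_of_one_le₀ (by linarith [Real.pi_gt_three])
  set w := 256 * (a + 1) with hw
  have hw0 : 0 < w := by positivity
  set s := Real.sin (Real.pi * a) with hs
  set c := Real.cos (Real.pi * a) with hcdef
  have hc0 : c ≠ 0 := by rintro h; rw [h] at hc; norm_num at hc
  have htan : Real.tan (Real.pi * (a - m)) = s / c := by
    rw [mul_sub, mul_comm Real.pi (m : ℝ), Real.tan_sub_int_mul_pi, Real.tan_eq_sin_div_cos]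
  obtain ⟨h1, h2⟩ := abs_le.1 hm
  have hcx : Real.cos (Real.pi * (a - m)) ≠ 0 := by
    intro h
    have h3 := Real.sin_sq_add_cos_sq (Real.pi * a - m * Real.pi)
    rw [show Real.pi * (a - m) = Real.pi * a - m * Real.pi by ring, Real.cos_sub_int_mul_pi] at h
    rcases mul_eq_zero.1 h with h | h
    · exact absurd h (zpow_ne_zero _ (by norm_num))
    · exact hc0 h
  have harc : Real.arctan (s / c) = Real.pi * (a - m) := by
    rw [← htan, Real.arctan_tan]
    · rcases eq_or_lt_of_le h1 with h | h
      · exact absurd (by rw [← h, show Real.pi * -(1 / 2) = -(Real.pi / 2) by ring, Real.cos_neg,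
          Real.cos_pi_div_two]) hcx
      · nlinarith
    · rcases eq_or_lt_of_le h2 with h | h
      · exact absurd (by rw [h, show Real.pi * (1 / 2) = Real.pi / 2 by ring,
          Real.cos_pi_div_two]) hcx
      · nlinarith
  have hkey : softRound a - m = Real.pi⁻¹ *
      (Real.arctan (s / c) - Real.arctan (s * c * w * (1 + c ^ 2 * w)⁻¹)) := by
    have h3 : softRound a = a - Real.pi⁻¹ * Real.arctan (s * c * w * (1 + c ^ 2 * w)⁻¹) := rfl
    rw [harc, h3, mul_sub, inv_mul_cancel_left₀ hp.ne']
    ring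
  have hden : 0 < 1 + c ^ 2 * w := by positivity
  have hdiff : |s / c - s * c * w * (1 + c ^ 2 * w)⁻¹| ≤ 8 / w := by
    have h3 : s / c - s * c * w * (1 + c ^ 2 * w)⁻¹ = s / (c * (1 + c ^ 2 * w)) := by
      field_simp
      ring
    have hca : 1 / 2 ≤ |c| := by
      by_contra! h
      have := sq_abs c
      nlinarith [abs_nonneg c]
    rw [h3, abs_div, abs_mul, abs_of_pos hden, div_le_div_iff₀ (by positivity) hw0]
    have h4 : |s| ≤ 1 := Real.abs_sin_le_one _
    have h5 : w / 8 ≤ |c| * (1 + c ^ 2 * w) := by nlinarith [mul_nonneg (sub_nonneg.2 hc) hw0.le]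
    nlinarith
  rw [hkey, abs_mul, abs_of_pos (by positivity)]
  exact (mul_le_of_le_one_left (abs_nonneg _) hp1).trans ((abs_arctan_sub_le _ _).trans hdiff)

/-- The time at which to read off the `n`-th configuration of a run of length about `2a`. -/
noncomputable def readTime (a n : ℝ) : ℝ := (2 * softRound a + 1) ^ 2 + n

lemma two_lt_readTime {a n : ℝ} (ha : 1 ≤ a) (hn : 0 < n) : 2 < readTime a n := by
  have := abs_le.1 (abs_softRound_sub_self_le a)
  unfold readTime
  nlinarith

lemma exists_readTime_close {a : ℝ} (ha : 1 ≤ a) (hc : 1 / 4 ≤ Real.cos (Real.pi * a) ^ 2) :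
    ∃ M : ℕ, Odd M ∧ a ≤ M ∧ ∀ n : ℕ, |readTime a n - (M ^ 2 + n : ℕ)| ≤ 1 / 4 := by
  have hm := abs_sub_round a
  obtain ⟨h1, h2⟩ := abs_le.1 hm
  obtain ⟨m, hm'⟩ : ∃ m : ℕ, round a = m := Int.eq_ofNat_of_zero_le (by
    have : (-1 : ℝ) < round a := by linarith
    have : (-1 : ℤ) < round a := by exact_mod_cast this
    omega)
  have h3 := abs_softRound_sub_le (by linarith) hm hc
  have h4 := abs_le.1 (abs_softRound_sub_self_le a)
  rw [hm', Int.cast_natCast] at h1 h2 h3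
  refine ⟨2 * m + 1, odd_two_mul_add_one m, by push_cast; linarith, fun n => ?_⟩
  -- Squaring amplifies the rounding error by at most `8 (a + 1)`; the weight `256 (a + 1)` in
  -- `softRound` is chosen to make the product `1/4`.
  have h5 : readTime a n - ((2 * m + 1) ^ 2 + n : ℕ) =
      (softRound a - m) * (4 * (softRound a + m + 1)) := by
    unfold readTime; push_cast; ring
  rw [h5, abs_mul]
  calc _ ≤ 8 / (256 * (a + 1)) * (8 * (a + 1)) := by
        refine mul_le_mul h3 ?_ (abs_nonneg _) (by positivity)
        exact abs_le.2 ⟨by linarith, by linarith⟩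
    _ = 1 / 4 := by field_simp; norm_num

section Gen

variable {A ι : Type*} [Fintype ι] {U : Set (ι → ℝ)}

lemma isGen_softRound {f : A → (ι → ℝ) → ℝ} (hf : IsGen U f) (h0 : ∀ a, ∀ v ∈ U, 0 ≤ f a v) :
    IsGen U fun a v => softRound (f a v) := by
  have hs := ((isGen_const (A := A) (U := U) Real.pi).mul hf).sin
  have hc := ((isGen_const (A := A) (U := U) Real.pi).mul hf).cos
  have hw := (isGen_const (A := A) (U := U) 256).mul (hf.add (isGen_const 1))
  refine hf.sub ((isGen_const _).mul (((hs.mul hc).mul hw).mul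
    (((isGen_const 1).add ((hc.pow 2).mul hw)).inv fun a v hv => ?_)).arctan)
  have := h0 a v hv
  have : 0 ≤ Real.cos (Real.pi * f a v) ^ 2 * (256 * (f a v + 1)) := by positivity
  linarith

lemma isGen_readTime {f g : A → (ι → ℝ) → ℝ} (hf : IsGen U f) (h0 : ∀ a, ∀ v ∈ U, 0 ≤ f a v)
    (hg : IsGen U g) : IsGen U fun a v => readTime (f a v) (g a v) :=
  ((((isGen_const 2).mul (isGen_softRound hf h0)).add (isGen_const 1)).pow 2).add hg

end Gen

/-- The weight that selects between the two readings. -/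
noncomputable def readWeight (ω a : ℝ) : ℝ :=
  Real.sigmoid (ω * (Real.cos (Real.pi * a) ^ 2 - 1 / 2))

/-- Each reading is either accurate or has weight at most `exp (-(S + 4B))`, and `4B ≤ exp (4B)`
makes that weight times `2B` at most `exp (-S) / 2`. -/
lemma abs_convex_sub_le {w x y p B S : ℝ} (hw0 : 0 ≤ w) (hw1 : w ≤ 1)
    (hx : |x - p| ≤ 2 * B) (hy : |y - p| ≤ 2 * B)
    (h : (|x - p| ≤ Real.exp (-S) / 2 ∨ w ≤ Real.exp (-(S + 4 * B))) ∧
      (|y - p| ≤ Real.exp (-S) / 2 ∨ 1 - w ≤ Real.exp (-(S + 4 * B)))) :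
    |w * x + (1 - w) * y - p| ≤ Real.exp (-S) := by
  have hE := Real.exp_pos (-S)
  have hB : 0 ≤ B := by linarith [(abs_nonneg _).trans hx]
  have hsmall : Real.exp (-(S + 4 * B)) * (2 * B) ≤ Real.exp (-S) / 2 := by
    have h1 : 4 * B ≤ Real.exp (4 * B) := by linarith [Real.add_one_le_exp (4 * B)]
    have h2 : Real.exp (-(S + 4 * B)) * Real.exp (4 * B) = Real.exp (-S) := by
      rw [← Real.exp_add]; ring_nf
    nlinarith [Real.exp_pos (-(S + 4 * B))]
  have hconv : w * x + (1 - w) * y - p = w * (x - p) + (1 - w) * (y - p) := by ring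
  rw [hconv]
  refine (abs_add_le _ _).trans ?_
  rw [abs_mul, abs_mul, abs_of_nonneg hw0, abs_of_nonneg (sub_nonneg.2 hw1)]
  have hx0 := abs_nonneg (x - p)
  have hy0 := abs_nonneg (y - p)
  have hterm : ∀ {u r : ℝ}, 0 ≤ u → u ≤ 1 → 0 ≤ r → r ≤ 2 * B →
      (r ≤ Real.exp (-S) / 2 ∨ u ≤ Real.exp (-(S + 4 * B))) → u * r ≤ Real.exp (-S) / 2 := by
    intro u r hu0 hu1 hr0 hr h
    rcases h with h | h
    · exact (mul_le_of_le_one_left hr0 hu1).trans h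
    · exact (mul_le_mul h hr hr0 (Real.exp_pos _).le).trans hsmall
  linarith [hterm hw0 hw1 hx0 hx h.1, hterm (sub_nonneg.2 hw1) (by linarith) hy0 hy h.2]

end GPAC

/-! ### The main theorem -/

theorem mainTheorem2 (M : GPAC.Machine) :
    ∃ s_f : (Fin 3 → ℝ) → ℝ,
      (∃ P : MvPolynomial (Fin 2) ℝ, ∀ S T n : ℝ, 0 < S → 0 < T → 0 < n → n ≤ T →
        |s_f ![S, T, n]| ≤ MvPolynomial.eval ![S, T] P) ∧
      ∀ c₀ : M.Config, ∃ f : (Fin 3 → ℝ) → Fin 4 → ℝ,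
        GPAC.GSpaceMultiVec GPAC.posOctant f s_f ∧
        ∀ S T : ℝ, 0 < S → 0 < T → ∀ n : ℕ, 0 < n → (n : ℝ) ≤ T →
          ‖M.encode (M.step^[n] c₀) - f ![S, T, (n : ℝ)]‖ ≤ Real.exp (-S) := by
  open GPAC in
  have hr : (0 : ℝ) ≤ M.r := Nat.cast_nonneg _
  have hB := M.stepBound_nonneg
  set B := M.stepBound
  obtain ⟨y, hyg, hyB, M₀, hy⟩ := exists_iteration (A := M.Config) (κ := Fin 4) (B := B)
    (η := 1 / (4 * (M.r + 1) * (M.r + 2))) (K := M.r + 2)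
    (C := 4 * (M.r + 2) + M.r + 4 * B) (F := fun i _ v => M.softStep i v)
    (V := fun c n => M.encode (M.step^[n] c)) hB (by positivity) (by linarith) (by positivity)
    (fun i => M.isGen_softStep i) (fun i _ t ht x => M.abs_softStep_le i ht x)
    (fun c n i => M.abs_encode_le _ i) (fun c t ht n x e he hx i => by
      rw [Function.iterate_succ_apply']
      exact M.softStep_close _ ht he hx i)
  -- An odd `N ≥ arg v` is past the threshold `M₀`, exceeds `T ≥ n` so that the run is long enough,
  -- and exceeds `S + 1`, where the extra `1` gives precision `exp (-S) / 2`.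
  let arg : (Fin 3 → ℝ) → ℝ := fun v => M₀ + 1 + v 0 + v 1
  have harg : ∀ v ∈ posOctant, 1 ≤ arg v := fun v hv => by
    have h0 := hv 0
    have h1 := hv 1
    have : (0 : ℝ) ≤ M₀ := Nat.cast_nonneg _
    simp only [arg]
    linarith
  have hargg : IsGen (A := M.Config) posOctant fun _ v => arg v :=
    ((isGen_const _).add (isGen_coord 0)).add (isGen_coord 1)
  let W : (Fin 3 → ℝ) → ℝ := fun v => readWeight (4 * (v 0 + 4 * B)) (arg v)
  have hW : IsGen (A := M.Config) posOctant fun _ v => W v :=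
    (((isGen_const _).mul ((isGen_coord 0).add (isGen_const _))).mul
      (((((isGen_const _).mul hargg).cos).pow 2).sub (isGen_const _))).sigmoid
  have hread : ∀ (s : ℝ), 0 ≤ s → ∀ i,
      IsGen posOctant fun (c : M.Config) v => y c (readTime (arg v + s) (v 2)) i := by
    intro s hs i
    refine (hyg i).comp (h := fun _ _ v => readTime (arg v + s) (v 2)) (fun _ => ?_)
      fun c v hv => two_lt_readTime (by linarith [harg v hv]) (hv 2)
    exact isGen_readTime (hargg.add (isGen_const s)) (fun c v hv => by linarith [harg v hv])
      (isGen_coord 2)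
  let f : M.Config → (Fin 3 → ℝ) → Fin 4 → ℝ := fun c v i =>
    W v * y c (readTime (arg v + 0) (v 2)) i + (1 - W v) * y c (readTime (arg v + 1 / 2) (v 2)) i
  have hf : ∀ i, IsGen posOctant fun (c : M.Config) v => f c v i := fun i =>
    (hW.mul (hread 0 le_rfl i)).add (((isGen_const 1).sub hW).mul (hread (1 / 2) (by norm_num) i))
  choose C p hC hspace using fun i => (hf i).gSpaceMulti
  have hCsum : 0 ≤ ∑ i, C i := Finset.sum_nonneg fun i _ => hC i
  -- `GSpaceMulti` evaluates `s_f` only at constant vectors, so the bound may depend on the first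
  -- coordinate alone.
  refine ⟨fun v => (∑ i, C i) * (1 + v 0) ^ (∑ i, p i),
    ⟨MvPolynomial.C (∑ i, C i) * (1 + MvPolynomial.X 0) ^ (∑ i, p i), fun S T n hS _ _ _ => ?_⟩,
    fun c => ⟨f c, fun i => ?_, fun S T hS hT n hn hnT => ?_⟩⟩
  · simp only [Matrix.cons_val_zero, map_mul, map_pow, map_add, map_one, MvPolynomial.eval_C,
      MvPolynomial.eval_X]
    rw [abs_of_nonneg (by positivity)]
  · exact hspace i _ (Finset.single_le_sum (fun i _ => hC i) (Finset.mem_univ i)) _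
      (Finset.single_le_sum (fun i _ => Nat.zero_le (p i)) (Finset.mem_univ i)) c
  have hn' : (0 : ℝ) < n := by exact_mod_cast hn
  have hv : ![S, T, (n : ℝ)] ∈ posOctant := by
    intro i
    fin_cases i
    exacts [hS, hT, hn']
  set v : Fin 3 → ℝ := ![S, T, (n : ℝ)] with hvdef
  have hargv : arg v = M₀ + 1 + S + T := rfl
  have hM₀ : (0 : ℝ) ≤ M₀ := Nat.cast_nonneg _
  have hgood : ∀ s : ℝ, 0 ≤ s → 1 / 4 ≤ Real.cos (Real.pi * (arg v + s)) ^ 2 → ∀ i,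
      |y c (readTime (arg v + s) n) i - M.encode (M.step^[n] c) i| ≤ Real.exp (-S) / 2 := by
    intro s hs hcos i
    obtain ⟨N, hodd, hN, hclose⟩ := exists_readTime_close (by linarith [harg v hv]) hcos
    have h1 : M₀ ≤ N := by
      have : (M₀ : ℝ) ≤ N := by linarith
      exact_mod_cast this
    have h2 : n ≤ N := by
      have : (n : ℝ) ≤ N := by linarith
      exact_mod_cast this
    refine (hy c N h1 hodd n h2 _ (hclose n) i).trans ?_
    have h3 : Real.exp (-(N : ℝ)) ≤ Real.exp (-S + -1) := Real.exp_le_exp.2 (by linarith)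
    have h4 : Real.exp (-1) ≤ 1 / 2 := by
      rw [Real.exp_neg, ← one_div]
      exact one_div_le_one_div_of_le (by norm_num) (by linarith [Real.add_one_le_exp 1])
    rw [Real.exp_add] at h3
    nlinarith [Real.exp_pos (-S)]
  have hbd : ∀ s : ℝ, 0 ≤ s → ∀ i,
      |y c (readTime (arg v + s) n) i - M.encode (M.step^[n] c) i| ≤ 2 * B := fun s hs i =>
    abs_sub_le_two_mul (hyB c _ (two_lt_readTime (by linarith [harg v hv]) hn') i)
      (M.abs_encode_le _ i)
  -- The two squared cosines sum to `1`, so at least one of the two readings is reliable.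
  have hcos2 : Real.cos (Real.pi * (arg v + 1 / 2)) ^ 2 = 1 - Real.cos (Real.pi * arg v) ^ 2 := by
    rw [mul_add, mul_one_div, Real.cos_add_pi_div_two, neg_sq, Real.sin_sq]
  have hcos1 : Real.cos (Real.pi * (arg v + 0)) ^ 2 = Real.cos (Real.pi * arg v) ^ 2 := by
    rw [add_zero]
  have hω : 0 ≤ S + 4 * B := by linarith
  have hW0 : 0 ≤ W v := Real.sigmoid_nonneg _
  have hW1 : W v ≤ 1 := Real.sigmoid_le_one _
  refine (pi_norm_le_iff_of_nonneg (Real.exp_pos _).le).2 fun i => ?_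
  rw [Pi.sub_apply, Real.norm_eq_abs, abs_sub_comm]
  refine abs_convex_sub_le (B := B) hW0 hW1 (hbd 0 le_rfl i) (hbd _ (by norm_num) i) ⟨?_, ?_⟩
  · by_cases h : 1 / 4 ≤ Real.cos (Real.pi * arg v) ^ 2
    · exact .inl (hgood 0 le_rfl (by rwa [hcos1]) i)
    · right
      refine sigmoid_le_exp_of_le ?_
      -- Here `cos² - 1/2 < -1/4`, and the factor `4` in the weight turns this into the exponent
      -- `-(S + 4B)`.
      change 4 * (S + 4 * B) * (Real.cos (Real.pi * arg v) ^ 2 - 1 / 2) ≤ _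
      nlinarith
  · by_cases h : 1 / 4 ≤ 1 - Real.cos (Real.pi * arg v) ^ 2
    · exact .inl (hgood (1 / 2) (by norm_num) (by rwa [hcos2]) i)
    · right
      refine one_sub_sigmoid_le_exp_of_le ?_
      change -(4 * (S + 4 * B) * (Real.cos (Real.pi * arg v) ^ 2 - 1 / 2)) ≤ _
      nlinarith
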